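/- **Setting.** There are finite sets $\mathcal A$ of $n_a$ analysis units and $\mathcal R$ of $n_r$ randomization units. The treatment vector $\mathbf T=(T_r)_{r\in\mathcal R}\in\{0,1\}^{n_r}$ has independent Bernoulli($p$) coordinates, $0<p<1$, and it is the only source of randomness. For $a\in\mathcal A$, $r\in\mathcal R$ there are an edge function $E_{ar}:\{0,1\}^{n_r}\to\{0,1\}$ and a potential outcome function $Y_a:\{0,1\}^{n_r}\to\mathbb R$; $Y_a(\mathbf T)$ depends only on the set $\{r: E_{ar}(\mathbf T)=1\}$ and on the treatments of the units in that set. Write $e_{ar}=E_{ar}(\mathbf T)$ and $y_a=Y_a(\mathbf T)$. Given real weights $w_{ar},u_{ar},c_{ar}$, put $x_a=\sum_r T_re_{ar}w_{ar}$, $z_a=\sum_r T_ru_{ar}$ and assume the linear model $y_a=\alpha_a+\beta_ax_a$ with constants $\alpha_a,\beta_a$. The total treatment effect and its estimator are $$\mu=\frac1{n_a}\sum_a\bigl[Y_a(\mathbf 1)-Y_a(\mathbf 0)\bigr],\qquad \hat\mu^{u,c}=\frac1{n_a}\sum_a\frac{y_a(z_a-\mathbb E z_a)}{\mathrm{Cov}(x_a,z_a)}\sum_r\Bigl(\frac{T_rw_{ar}(e_{ar}-c_{ar})}{p}+w_{ar}c_{ar}\Bigr).$$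 Let $R_a=\{r: E_{ar}(\mathbf 1)=1\}$, $A_r=\{a: E_{ar}(\mathbf 1)=1\}$, $V_a=\{r: u_{ar}\neq0\}$, $d_{\mathcal A}=\max_a|R_a|$, $d_{\mathcal R}=\max_r|A_r|$. **Assumptions.** Let $G\subset\mathcal A\times\mathcal R$ be an anchor subgraph, i.e. $E_{ar}(\mathbf t)=1$ for all $(a,r)\in G$ and all $\mathbf t\in\{0,1\}^{n_r}$. Assume that 1. edges are $r$-driven: $E_{ar}(\mathbf t)$ depends only on $t_r$; 2. $u_{ar}\ne0$ implies $(a,r)\in G$; $c_{ar}=1$ if $(a,r)\in G$ and $c_{ar}=0$ otherwise; $w_{ar}\neq0$ for $(a,r)\in G$; and $V_a\ne\emptyset$ for every $a$; 3. $u_{ar}\ge0$ for all $a,r$; 4. $W_l/|R_a|\le|w_{ar}|\le W_h/|R_a|$ for all $a$ and $r\in R_a$, and for each $a$ the weights $w_{ar}$, $r\in V_a$, all have the same sign; 5. $|Y_a(\mathbf t)|\le M$ for all $a$ and $\mathbf t$; 6. $p\ge\delta$ and $1-p\ge\delta$. Here $\delta,W_l,W_h,M>0$ are fixed constants. **Theorem.**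 (i) There is a constant $C$ depending only on $\delta,W_l,W_h,M$ such that every experiment satisfying these assumptions has $\mathrm{Var}(\hat\mu^{u,c})\le C\,d_{\mathcal A}^3d_{\mathcal R}/n_a$. Consequently, for every sequence of experiments satisfying the assumptions with the same constants and with $d_{\mathcal A}^3d_{\mathcal R}/n_a\to0$, the estimator is consistent: $\hat\mu^{u,c}-\mu\to0$ in probability. (ii) For every sequence of experiments satisfying the assumptions with the same constants, if $n_a\mathrm{Var}(\hat\mu^{u,c})$ is bounded away from zero and $d_{\mathcal A}^{10}d_{\mathcal R}^4/n_a\to0$, then $(\hat\mu^{u,c}-\mu)/\sqrt{\mathrm{Var}(\hat\mu^{u,c})}$ converges in distribution to $\mathcal N(0,1)$. -/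

import Mathlib

open MeasureTheory ProbabilityTheory Filter Topology

/-- Numerical value of a binary variable: `true ↦ 1`, `false ↦ 0`. -/
def bitVal (b : Bool) : ℝ := if b then 1 else 0

/-- An endogenous bipartite interference graph on analysis units `A` and randomization units `R`.
Treatment assignments are the elements of `R → Bool`. `E a r T` tells whether the edge `(a, r)`
exists under `T`, and `Y a T` is the potential outcome of `a` under `T`. The outcome of `a` may
only depend on the set of units `a` is connected to and on the treatments of those units. -/
structure EndogenousBipartiteGraph (A R : Type*) where
  E : A → R → (R → Bool) → Bool
  Y : A → (R → Bool) → ℝ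
  outcome_eq : ∀ (a : A) (T T' : R → Bool),
    {r | E a r T = true} = {r | E a r T' = true} →
    (∀ r, E a r T = true → T r = T' r) → Y a T = Y a T'

/-- A bipartite experiment: an endogenous bipartite interference graph, together with the treatment
probability `p`, the edge weights `w`, the instrument weights `u`, the augmentation constants `c`
and a set `G` of pairs (the candidate anchor subgraph). -/
structure BipartiteExperiment (A R : Type*) extends EndogenousBipartiteGraph A R where
  p : unitInterval
  w : A → R → ℝ
  u : A → R → ℝ
  c : A → R → ℝ
  G : Set (A × R)

namespace BipartiteExperiment

/-- `G` is an anchor subgraph: its edges exist under every treatment assignment. -/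
def IsAnchor {A R : Type*} (X : BipartiteExperiment A R) : Prop :=
  ∀ a r, (a, r) ∈ X.G → ∀ T, X.E a r T = true

/-- Edges are `r`-driven: `E a r` depends on the treatment of `r` only. -/
def RDriven {A R : Type*} (X : BipartiteExperiment A R) : Prop :=
  ∀ (a : A) (r : R) (T T' : R → Bool), T r = T' r → X.E a r T = X.E a r T'

noncomputable section

variable {A R : Type*} [Fintype A] [Fintype R] (X : BipartiteExperiment A R)

/-- The law of the treatment vector: independent Bernoulli(`p`) coordinates. -/
def law : Measure (R → Bool) := Measure.pi fun _ => bernoulliMeasure true false X.p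

instance : IsProbabilityMeasure X.law := by
  unfold law; infer_instance

/-- Treatment exposure `x_a = ∑_r T_r e_{ar} w_{ar}`. -/
def exposure (a : A) (T : R → Bool) : ℝ := ∑ r, bitVal (T r) * bitVal (X.E a r T) * X.w a r

/-- The generalized linear exposure-response model `y_a = α_a + β_a x_a`. -/
def LinearOutcomes : Prop :=
  ∃ α β : A → ℝ, ∀ a T, X.Y a T = α a + β a * X.exposure a T

/-- The instrument `z_a = ∑_r T_r u_{ar}`. -/
def instrument (a : A) (T : R → Bool) : ℝ := ∑ r, bitVal (T r) * X.u a r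

/-- The estimator `y_a (z_a - 𝔼 z_a) / Cov(x_a, z_a)` of the slope of unit `a`. -/
def betaHat (a : A) (T : R → Bool) : ℝ :=
  X.Y a T * (X.instrument a T - ∫ T', X.instrument a T' ∂X.law) /
    covariance (X.exposure a) (X.instrument a) X.law

/-- The augmented inverse probability weighted estimator of the total edge weight of `a`
under full treatment, `∑_r (T_r w_{ar} (e_{ar} - c_{ar}) / p + w_{ar} c_{ar})`. -/
def weightHat (a : A) (T : R → Bool) : ℝ :=
  ∑ r, (bitVal (T r) * X.w a r * (bitVal (X.E a r T) - X.c a r) / (X.p : ℝ) + X.w a r * X.c a r)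

/-- The estimator of the total treatment effect. -/
def muHat (T : R → Bool) : ℝ :=
  1 / (Fintype.card A : ℝ) * ∑ a, X.betaHat a T * X.weightHat a T

/-- The total treatment effect. -/
def tte : ℝ :=
  1 / (Fintype.card A : ℝ) * ∑ a, (X.Y a (fun _ => true) - X.Y a (fun _ => false))

/-- Variance of the estimator under the treatment assignment. -/
def varMuHat : ℝ := variance X.muHat X.law

/-- `R_a`: the randomization units connected to `a` under full treatment. -/
def unitsOf (a : A) : Finset R := {r | X.E a r (fun _ => true) = true}

/-- `A_r`: the analysis units connected to `r` under full treatment. -/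
def analysisOf (r : R) : Finset A := {a | X.E a r (fun _ => true) = true}

/-- `d_A = max_a |R_a|`. -/
def degA : ℕ := Finset.univ.sup fun a => (X.unitsOf a).card

/-- `d_R = max_r |A_r|`. -/
def degR : ℕ := Finset.univ.sup fun r => (X.analysisOf r).card

/-- The conditions under which the estimator is unbiased; independence of the Bernoulli
treatments is part of `law`. -/
structure BasicAssumptions : Prop where
  linear : X.LinearOutcomes
  anchor : X.IsAnchor
  rDriven : X.RDriven
  p_pos : 0 < (X.p : ℝ)
  p_lt_one : (X.p : ℝ) < 1
  u_support : ∀ a r, X.u a r ≠ 0 → (a, r) ∈ X.G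
  c_eq : ∀ a r, X.c a r = X.G.indicator (fun _ => (1 : ℝ)) (a, r)
  w_ne_zero : ∀ a r, (a, r) ∈ X.G → X.w a r ≠ 0
  u_nontrivial : ∀ a, ∃ r, X.u a r ≠ 0

/-- The conditions for consistency and asymptotic normality, with bounds `δ`, `Wl`, `Wh`, `M`.
`same_sign` says that, for each analysis unit, the edge weights on which the instrument is
supported have a common sign. -/
structure AsymptoticAssumptions (δ Wl Wh M : ℝ) : Prop extends X.BasicAssumptions where
  p_lower : δ ≤ (X.p : ℝ)
  p_upper : δ ≤ 1 - (X.p : ℝ)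
  u_nonneg : ∀ a r, 0 ≤ X.u a r
  same_sign : ∀ a r r', X.u a r ≠ 0 → X.u a r' ≠ 0 → 0 < X.w a r * X.w a r'
  w_lower : ∀ a, ∀ r ∈ X.unitsOf a, Wl / ((X.unitsOf a).card : ℝ) ≤ |X.w a r|
  w_upper : ∀ a, ∀ r ∈ X.unitsOf a, |X.w a r| ≤ Wh / ((X.unitsOf a).card : ℝ)
  bounded : ∀ a T, |X.Y a T| ≤ M

end

end BipartiteExperiment

/-!
The summand of the estimator attached to `a` is a bounded function of the treatments of the units
in `R_a` alone. Split `R_a` into anchor and non-anchor units. The instrument only sees the anchor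
units and `weightHat` is only random through the non-anchor ones, so the two are independent; the
non-anchor exposure meets the centred instrument only in products of mean zero. Each summand is
therefore unbiased.

As the treatments are independent, joining `a` and `a'` when `R_a` and `R_{a'}` meet yields a
dependency graph, with closed neighbourhoods of size at most `D = d_A d_R`. Only equal or adjacent
pairs contribute to the variance, which is at most `n D B ^ 2` if the summands are bounded by `B`.
For the normal limit, standardize the sum to `W` and test Stein's identity on `exp (itW)`: replacing
each summand times `exp (itW)` by its first-order expansion in the local sum around it costs
`O(n D ^ 2 B ^ 3 / σ ^ 3)`, and the quadratic form so produced has mean `1` and fluctuations of the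
same order. The identity says that the characteristic function `φ` of `W` nearly solves
`φ' = -t φ`.
-/

section BoundedVariables

variable {Ω : Type*} [MeasurableSpace Ω] {μ : Measure Ω} {B : ℝ}

theorem memLp_of_ae_abs_le [IsFiniteMeasure μ] {X : Ω → ℝ} (hX : AEMeasurable X μ)
    (hB : ∀ᵐ ω ∂μ, |X ω| ≤ B) (q : ENNReal) : MemLp X q μ :=
  .of_bound hX.aestronglyMeasurable B hB

variable [IsProbabilityMeasure μ]

theorem nonneg_of_ae_abs_le {X : Ω → ℝ} (hB : ∀ᵐ ω ∂μ, |X ω| ≤ B) : 0 ≤ B :=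
  let ⟨_, h⟩ := hB.exists
  (abs_nonneg _).trans h

theorem abs_integral_le_of_ae_abs_le {X : Ω → ℝ} (hB : ∀ᵐ ω ∂μ, |X ω| ≤ B) :
    |∫ ω, X ω ∂μ| ≤ B := by
  simpa using norm_integral_le_of_norm_le_const (f := X) hB

theorem variance_le_sq_of_ae_abs_le {X : Ω → ℝ} (hX : AEMeasurable X μ)
    (hB : ∀ᵐ ω ∂μ, |X ω| ≤ B) : Var[X; μ] ≤ B ^ 2 := by
  simpa using variance_le_sq_of_bounded (hB.mono fun _ h => abs_le.1 h) hX

theorem covariance_le_sq_of_ae_abs_le {X Y : Ω → ℝ} (hX : AEMeasurable X μ)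
    (hY : AEMeasurable Y μ) (hXB : ∀ᵐ ω ∂μ, |X ω| ≤ B) (hYB : ∀ᵐ ω ∂μ, |Y ω| ≤ B) :
    cov[X, Y; μ] ≤ B ^ 2 := by
  have hsub := variance_sub (memLp_of_ae_abs_le hX hXB 2) (memLp_of_ae_abs_le hY hYB 2)
  linarith [variance_nonneg (X - Y) μ, variance_le_sq_of_ae_abs_le hX hXB,
    variance_le_sq_of_ae_abs_le hY hYB]

theorem variance_sum_le_of_covariance_eq_zero {κ : Type*} {s : Finset κ} {X : κ → Ω → ℝ}
    (hX : ∀ i ∈ s, AEMeasurable (X i) μ) (hB : ∀ i ∈ s, ∀ᵐ ω ∂μ, |X i ω| ≤ B)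
    {N : κ → Finset κ} (hN : ∀ i ∈ s, ∀ j ∈ s, j ∉ N i → cov[X i, X j; μ] = 0)
    {D : ℕ} (hD : ∀ i ∈ s, (N i).card ≤ D) :
    Var[fun ω => ∑ i ∈ s, X i ω; μ] ≤ s.card * D * B ^ 2 := by
  classical
  have hrow : ∀ i ∈ s, ∑ j ∈ s, cov[X i, X j; μ] ≤ D * B ^ 2 := fun i hi =>
    calc ∑ j ∈ s, cov[X i, X j; μ]
        ≤ ∑ j ∈ s, if j ∈ N i then B ^ 2 else 0 := by
          refine Finset.sum_le_sum fun j hj => ?_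
          split_ifs with hij
          · exact covariance_le_sq_of_ae_abs_le (hX i hi) (hX j hj) (hB i hi) (hB j hj)
          · exact (hN i hi j hj hij).le
      _ = (s ∩ N i).card * B ^ 2 := by
          rw [← Finset.sum_filter, Finset.sum_const, nsmul_eq_mul, Finset.filter_mem_eq_inter]
      _ ≤ D * B ^ 2 := by
          gcongr
          exact (Finset.card_le_card Finset.inter_subset_right).trans (hD i hi)
  rw [variance_fun_sum' fun i hi => memLp_of_ae_abs_le (hX i hi) (hB i hi) 2]
  simpa [mul_assoc] using Finset.sum_le_card_nsmul s _ _ hrow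

theorem integral_abs_sub_integral_le_sqrt_variance {X : Ω → ℝ} (hX : MemLp X 2 μ) :
    ∫ ω, |X ω - ∫ ω', X ω' ∂μ| ∂μ ≤ √Var[X; μ] := by
  have hdev : MemLp (fun ω => X ω - ∫ ω', X ω' ∂μ) 2 μ := hX.sub (memLp_const _)
  have hvar := variance_nonneg |fun ω => X ω - ∫ ω', X ω' ∂μ| μ
  rw [variance_eq_sub hdev.abs] at hvar
  apply Real.le_sqrt_of_sq_le
  rw [variance_eq_integral hX.1.aemeasurable]
  simpa using hvar

theorem integral_affine_mul_centered {X Z : Ω → ℝ} (hX : MemLp X 2 μ) (hZ : MemLp Z 2 μ)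
    (α β : ℝ) : ∫ ω, (α + β * X ω) * (Z ω - ∫ ω', Z ω' ∂μ) ∂μ = β * cov[X, Z; μ] := by
  have hY : MemLp (fun ω => α + β * X ω) 2 μ := (memLp_const α).add (hX.const_mul β)
  have hXi : Integrable (fun ω => β * X ω) μ := (hX.const_mul β).integrable (by norm_num)
  have hYZ : Integrable (fun ω => (α + β * X ω) * Z ω) μ := hY.integrable_mul hZ
  calc ∫ ω, (α + β * X ω) * (Z ω - ∫ ω', Z ω' ∂μ) ∂μ
      = cov[fun ω => α + β * X ω, Z; μ] := by
        simp_rw [mul_sub]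
        rw [integral_sub hYZ ((hY.integrable (by norm_num)).mul_const _),
          integral_mul_const, covariance_eq_sub hY hZ]
        rfl
    _ = β * cov[X, Z; μ] := by
        rw [covariance_const_add_left hXi, covariance_const_mul_left]

theorem integral_affine_mul_centered_mul_of_indepFun {X Z X' V : Ω → ℝ} (hX : MemLp X 2 μ)
    (hZ : MemLp Z 2 μ) (hV : Integrable V μ) (hXV : Integrable (fun ω => X' ω * V ω) μ)
    (hind : IndepFun (fun ω => (X ω, Z ω)) (fun ω => (X' ω, V ω)) μ) (α β : ℝ) :
    ∫ ω, (α + β * (X ω + X' ω)) * (Z ω - ∫ ω', Z ω' ∂μ) * V ω ∂μ =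
      β * cov[X, Z; μ] * ∫ ω, V ω ∂μ := by
  set z := ∫ ω', Z ω' ∂μ with hz
  have hZc : MemLp (fun ω => Z ω - z) 2 μ := hZ.sub (memLp_const z)
  have hint₁ : Integrable (fun ω => (α + β * X ω) * (Z ω - z)) μ :=
    ((memLp_const α).add (hX.const_mul β)).integrable_mul hZc
  have hint₂ : Integrable (fun ω => Z ω - z) μ := hZc.integrable (by norm_num)
  have hind₁ : IndepFun (fun ω => (α + β * X ω) * (Z ω - z)) V μ :=
    hind.comp (φ := fun q : ℝ × ℝ => (α + β * q.1) * (q.2 - z)) (by fun_prop) measurable_snd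
  have hind₂ : IndepFun (fun ω => Z ω - z) (fun ω => X' ω * V ω) μ :=
    hind.comp (φ := fun q : ℝ × ℝ => q.2 - z) (ψ := fun q : ℝ × ℝ => q.1 * q.2)
      (by fun_prop) (by fun_prop)
  have hint₃ : Integrable (fun ω => (α + β * X ω) * (Z ω - z) * V ω) μ :=
    hind₁.integrable_mul hint₁ hV
  have hint₄ : Integrable (fun ω => (Z ω - z) * (X' ω * V ω)) μ :=
    hind₂.integrable_mul hint₂ hXV
  have hzero : ∫ ω, (Z ω - z) ∂μ = 0 := by
    rw [integral_sub (hZ.integrable (by norm_num)) (integrable_const z)]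
    simp [hz]
  calc ∫ ω, (α + β * (X ω + X' ω)) * (Z ω - z) * V ω ∂μ
      = ∫ ω, (α + β * X ω) * (Z ω - z) * V ω + β * ((Z ω - z) * (X' ω * V ω)) ∂μ := by
        congr with ω; ring
    _ = (∫ ω, (α + β * X ω) * (Z ω - z) ∂μ) * (∫ ω, V ω ∂μ) +
          β * ((∫ ω, (Z ω - z) ∂μ) * ∫ ω, X' ω * V ω ∂μ) := by
        rw [integral_add hint₃ (hint₄.const_mul β), integral_const_mul,
          hind₁.integral_fun_mul_eq_mul_integral hint₁.1 hV.1,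
          hind₂.integral_fun_mul_eq_mul_integral hint₂.1 hXV.1]
    _ = β * cov[X, Z; μ] * ∫ ω, V ω ∂μ := by
        rw [integral_affine_mul_centered hX hZ, hzero]
        ring

end BoundedVariables

section CharacteristicFunctions

theorem norm_cexp_mul_I_sub_one_sub_le (x : ℝ) :
    ‖Complex.exp (x * Complex.I) - 1 - x * Complex.I‖ ≤ 2 * x ^ 2 := by
  have hnorm : ‖(x : ℂ) * Complex.I‖ = |x| := by simp
  rcases le_total |x| 1 with hx | hx
  · have := Complex.norm_exp_sub_one_sub_id_le (hnorm.trans_le hx)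
    rw [hnorm, sq_abs] at this
    linarith [sq_nonneg x]
  · have hexp : ‖Complex.exp (x * Complex.I) - 1‖ ≤ |x| := by
      simpa [mul_comm] using Real.norm_exp_I_mul_ofReal_sub_one_le (x := x)
    calc ‖Complex.exp (x * Complex.I) - 1 - x * Complex.I‖
        ≤ |x| + |x| := (norm_sub_le _ _).trans (add_le_add hexp hnorm.le)
      _ ≤ 2 * x ^ 2 := by nlinarith [sq_abs x]

-- The factor `exp (s ^ 2 / 2)` integrates the differential inequality `‖φ' + s φ‖ ≤ ε`.
theorem norm_sub_cexp_neg_sq_div_two_le {φ : ℝ → ℂ} (hφ : Differentiable ℝ φ) (h0 : φ 0 = 1)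
    {t ε : ℝ} (hε : ∀ s : ℝ, |s| ≤ |t| → ‖deriv φ s + s * φ s‖ ≤ ε) :
    ‖φ t - Complex.exp (-(t ^ 2 / 2))‖ ≤ |t| * ε := by
  have hnorm (s : ℝ) : ‖Complex.exp ((s : ℂ) ^ 2 / 2)‖ = Real.exp (s ^ 2 / 2) := by
    rw [Complex.norm_exp]
    norm_cast
  have hderiv (s : ℝ) : HasDerivAt (fun s : ℝ => φ s * Complex.exp ((s : ℂ) ^ 2 / 2))
      ((deriv φ s + s * φ s) * Complex.exp ((s : ℂ) ^ 2 / 2)) s := by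
    have hexp : HasDerivAt (fun s : ℝ => Complex.exp ((s : ℂ) ^ 2 / 2))
        (Complex.exp ((s : ℂ) ^ 2 / 2) * s) s :=
      (((Complex.ofRealCLM.hasDerivAt (x := s)).fun_pow 2).div_const 2).cexp.congr_deriv
        (by simp)
    exact ((hφ s).hasDerivAt.mul hexp).congr_deriv (by ring)
  have hbound : ∀ s ∈ Set.uIcc 0 t,
      ‖(deriv φ s + s * φ s) * Complex.exp ((s : ℂ) ^ 2 / 2)‖ ≤ ε * Real.exp (t ^ 2 / 2) := by
    intro s hs
    have hst : |s| ≤ |t| := by simpa using Set.abs_sub_left_of_mem_uIcc hs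
    rw [norm_mul, hnorm]
    have := sq_le_sq.2 hst
    exact mul_le_mul (hε s hst) (Real.exp_le_exp.2 (by linarith)) (Real.exp_pos _).le
      ((norm_nonneg _).trans (hε s hst))
  have hmean := (convex_uIcc (0 : ℝ) t).norm_image_sub_le_of_norm_hasDerivWithin_le
    (fun s _ => (hderiv s).hasDerivWithinAt) hbound Set.left_mem_uIcc Set.right_mem_uIcc
  have hfactor : φ t * Complex.exp ((t : ℂ) ^ 2 / 2) - φ 0 * Complex.exp (((0 : ℝ) : ℂ) ^ 2 / 2) =
      (φ t - Complex.exp (-(t ^ 2 / 2))) * Complex.exp ((t : ℂ) ^ 2 / 2) := by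
    rw [sub_mul, ← Complex.exp_add]
    simp [h0]
  rw [hfactor, norm_mul, hnorm, sub_zero, Real.norm_eq_abs] at hmean
  exact le_of_mul_le_mul_right (by linarith) (Real.exp_pos (t ^ 2 / 2))

theorem norm_cexp_sub_cexp_sub_le (t w l : ℝ) :
    ‖Complex.exp (t * w * Complex.I) - Complex.exp (t * (w - l : ℝ) * Complex.I) -
      t * Complex.I * (l * Complex.exp (t * w * Complex.I))‖ ≤ 2 * (t * l) ^ 2 := by
  have hfactor : Complex.exp (t * w * Complex.I) - Complex.exp (t * (w - l : ℝ) * Complex.I) -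
      t * Complex.I * (l * Complex.exp (t * w * Complex.I)) =
      -(Complex.exp ((t * w : ℝ) * Complex.I) *
        (Complex.exp ((-(t * l) : ℝ) * Complex.I) - 1 - (-(t * l) : ℝ) * Complex.I)) := by
    rw [mul_sub, mul_sub, ← Complex.exp_add]
    push_cast
    ring_nf
  rw [hfactor, norm_neg, norm_mul, Complex.norm_exp_ofReal_mul_I, one_mul]
  simpa using norm_cexp_mul_I_sub_one_sub_le (-(t * l))

variable {Ω : Type*} [MeasurableSpace Ω] {μ : Measure Ω}

theorem charFun_map_eq_integral {W : Ω → ℝ} (hW : AEMeasurable W μ) (t : ℝ) :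
    charFun (μ.map W) t = ∫ ω, Complex.exp (t * W ω * Complex.I) ∂μ := by
  rw [charFun_apply_real, integral_map hW (by fun_prop)]

theorem memLp_id_map {W : Ω → ℝ} {q : ENNReal} (hW : MemLp W q μ) : MemLp id q (μ.map W) :=
  (memLp_map_measure_iff aestronglyMeasurable_id hW.1.aemeasurable).2 hW

theorem integrable_mul_cexp {Y W : Ω → ℝ} (hY : Integrable Y μ) (hW : AEMeasurable W μ) (t : ℝ) :
    Integrable (fun ω => Y ω * Complex.exp (t * W ω * Complex.I)) μ :=
  hY.ofReal.mul_bdd (c := 1) (by fun_prop)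
    (.of_forall fun ω => by simpa using (Complex.norm_exp_ofReal_mul_I (t * W ω)).le)

theorem integral_mul_cexp_eq_zero_of_indepFun {Y V : Ω → ℝ} (hind : IndepFun Y V μ)
    (hY : AEMeasurable Y μ) (hV : AEMeasurable V μ) (h0 : ∫ ω, Y ω ∂μ = 0) (t : ℝ) :
    ∫ ω, Y ω * Complex.exp (t * V ω * Complex.I) ∂μ = 0 := by
  have hindC : IndepFun (fun ω => (Y ω : ℂ)) (fun ω => Complex.exp (t * V ω * Complex.I)) μ :=
    hind.comp (φ := fun y : ℝ => (y : ℂ)) (ψ := fun v : ℝ => Complex.exp (t * v * Complex.I))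
      (by fun_prop) (by fun_prop)
  rw [hindC.integral_fun_mul_eq_mul_integral (by fun_prop) (by fun_prop),
    integral_complex_ofReal, h0, Complex.ofReal_zero, zero_mul]

variable [IsProbabilityMeasure μ]

theorem differentiable_charFun_map {W : Ω → ℝ} (hW : MemLp W 1 μ) :
    Differentiable ℝ (charFun (μ.map W)) := by
  have := Measure.isProbabilityMeasure_map hW.1.aemeasurable (μ := μ)
  have h := memLp_id_map hW
  exact (contDiff_charFun (n := 1) (by exact_mod_cast h)).differentiable (by simp)

theorem deriv_charFun_map {W : Ω → ℝ} (hW : MemLp W 1 μ) (t : ℝ) :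
    deriv (charFun (μ.map W)) t =
      Complex.I * ∫ ω, W ω * Complex.exp (t * W ω * Complex.I) ∂μ := by
  have := Measure.isProbabilityMeasure_map hW.1.aemeasurable (μ := μ)
  have h := iteratedDeriv_charFun (n := 1) (by exact_mod_cast memLp_id_map hW) (t := t)
  rw [iteratedDeriv_one, integral_map hW.1.aemeasurable (by fun_prop)] at h
  simpa using h

-- `E[W exp (isW)] ≈ is E[exp (isW)]` is Stein's identity tested on `exp (is·)`.
theorem norm_charFun_map_sub_le_of_stein {W : Ω → ℝ} (hW : MemLp W 1 μ) {t ε : ℝ}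
    (hε : ∀ s : ℝ, |s| ≤ |t| → ‖(∫ ω, W ω * Complex.exp (s * W ω * Complex.I) ∂μ) -
      s * Complex.I * ∫ ω, Complex.exp (s * W ω * Complex.I) ∂μ‖ ≤ ε) :
    ‖charFun (μ.map W) t - Complex.exp (-(t ^ 2 / 2))‖ ≤ |t| * ε := by
  have hWm := hW.1.aemeasurable
  have := Measure.isProbabilityMeasure_map hWm
  refine norm_sub_cexp_neg_sq_div_two_le (differentiable_charFun_map hW) (by simp) fun s hs => ?_
  rw [deriv_charFun_map hW, charFun_map_eq_integral hWm]
  refine le_of_eq_of_le ?_ (hε s hs)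
  rw [← one_mul ‖_ - _‖, ← Complex.norm_I, ← norm_mul]
  congr 1
  linear_combination (s * ∫ ω, Complex.exp (s * W ω * Complex.I) ∂μ) * Complex.I_sq

theorem norm_integral_mul_cexp_sub_le {Y W L : Ω → ℝ} {B C : ℝ}
    (hind : IndepFun Y (fun ω => W ω - L ω) μ) (hY : AEMeasurable Y μ) (hW : AEMeasurable W μ)
    (hL : AEMeasurable L μ) (h0 : ∫ ω, Y ω ∂μ = 0) (hB : ∀ᵐ ω ∂μ, |Y ω| ≤ B)
    (hC : ∀ᵐ ω ∂μ, |L ω| ≤ C) (t : ℝ) :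
    ‖(∫ ω, Y ω * Complex.exp (t * W ω * Complex.I) ∂μ) -
      t * Complex.I * ∫ ω, (Y ω * L ω : ℝ) * Complex.exp (t * W ω * Complex.I) ∂μ‖ ≤
      2 * t ^ 2 * (B * C ^ 2) := by
  have hYi : Integrable Y μ := .of_bound hY.aestronglyMeasurable B hB
  have hYLi : Integrable (fun ω => Y ω * L ω) μ := hYi.mul_bdd hL.aestronglyMeasurable hC
  have hWL : AEMeasurable (fun ω => W ω - L ω) μ := hW.sub hL
  have hYe := integrable_mul_cexp hYi hW t
  have hYe' := integrable_mul_cexp hYi hWL t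
  have hYLe := (integrable_mul_cexp hYLi hW t).const_mul (t * Complex.I)
  have hdiff : Integrable (fun ω => Y ω * Complex.exp (t * W ω * Complex.I) -
    Y ω * Complex.exp (t * (W ω - L ω : ℝ) * Complex.I)) μ := hYe.sub hYe'
  have hbound : ∀ᵐ ω ∂μ, ‖Y ω * Complex.exp (t * W ω * Complex.I) -
      Y ω * Complex.exp (t * (W ω - L ω : ℝ) * Complex.I) -
      t * Complex.I * ((Y ω * L ω : ℝ) * Complex.exp (t * W ω * Complex.I))‖ ≤
      2 * t ^ 2 * (B * C ^ 2) := by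
    filter_upwards [hB, hC] with ω hYω hLω
    calc _ = |Y ω| * ‖Complex.exp (t * W ω * Complex.I) -
            Complex.exp (t * (W ω - L ω : ℝ) * Complex.I) -
            t * Complex.I * (L ω * Complex.exp (t * W ω * Complex.I))‖ := by
          rw [← Real.norm_eq_abs, ← Complex.norm_real, ← norm_mul]
          push_cast
          ring_nf
      _ ≤ B * (2 * (t ^ 2 * C ^ 2)) := by
          have hB0 := (abs_nonneg _).trans hYω
          refine mul_le_mul hYω ((norm_cexp_sub_cexp_sub_le _ _ _).trans ?_) (norm_nonneg _) hB0
          rw [mul_pow, ← sq_abs (L ω)]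
          gcongr
      _ = 2 * t ^ 2 * (B * C ^ 2) := by ring
  rw [← sub_zero (∫ ω, Y ω * Complex.exp (t * W ω * Complex.I) ∂μ),
    ← integral_mul_cexp_eq_zero_of_indepFun hind hY hWL h0 t, ← integral_sub hYe hYe',
    ← integral_const_mul, ← integral_sub hdiff hYLe]
  simpa using norm_integral_le_of_norm_le_const hbound

end CharacteristicFunctions

section DependencyGraphs

variable {ι Ω E F : Type*} [MeasurableSpace Ω] [MeasurableSpace E] [MeasurableSpace F]
  {μ : Measure Ω} {G : SimpleGraph ι}

/-- `G` is a dependency graph for the random variables `X i`: subfamilies indexed by two sets of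
vertices that are disjoint and joined by no edge are independent. -/
structure IsDependencyGraph (G : SimpleGraph ι) (X : ι → Ω → E) (μ : Measure Ω) : Prop where
  aemeasurable : ∀ i, AEMeasurable (X i) μ
  indepFun : ∀ s t : Finset ι, (∀ i ∈ s, ∀ j ∈ t, i ≠ j ∧ ¬G.Adj i j) →
    IndepFun (fun ω (i : s) => X i ω) (fun ω (j : t) => X j ω) μ

theorem IsDependencyGraph.comp {X : ι → Ω → E} (h : IsDependencyGraph G X μ) {f : ι → E → F}
    (hf : ∀ i, Measurable (f i)) : IsDependencyGraph G (fun i ω => f i (X i ω)) μ where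
  aemeasurable i := (hf i).comp_aemeasurable (h.aemeasurable i)
  indepFun s t hst := (h.indepFun s t hst).comp
    (φ := fun (x : s → E) (i : s) => f i (x i)) (ψ := fun (x : t → E) (j : t) => f j (x j))
    (by fun_prop) (by fun_prop)

theorem IsDependencyGraph.aemeasurable_sum {X : ι → Ω → ℝ} (h : IsDependencyGraph G X μ)
    (s : Finset ι) : AEMeasurable (fun ω => ∑ i ∈ s, X i ω) μ :=
  Finset.aemeasurable_fun_sum s fun i _ => h.aemeasurable i

variable [Fintype ι]

open Classical in
/-- The closed neighbourhood of the vertex `i`: the range of dependence of the variable attached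
to `i` when `G` is a dependency graph. -/
noncomputable def closedNeighborFinset (G : SimpleGraph ι) (i : ι) : Finset ι :=
  {j | i = j ∨ G.Adj i j}

theorem mem_closedNeighborFinset {i j : ι} :
    j ∈ closedNeighborFinset G i ↔ i = j ∨ G.Adj i j := by
  simp [closedNeighborFinset]

theorem mem_closedNeighborFinset_comm {i j : ι} :
    j ∈ closedNeighborFinset G i ↔ i ∈ closedNeighborFinset G j := by
  rw [mem_closedNeighborFinset, mem_closedNeighborFinset, eq_comm, G.adj_comm]

/-- The quadratic form `∑ x i * x j` over the pairs of equal or adjacent vertices. Its mean at a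
centred family with dependency graph `G` is the variance of the sum of the family. -/
noncomputable def localQuadraticForm (G : SimpleGraph ι) (x : ι → ℝ) : ℝ :=
  ∑ i, x i * ∑ j ∈ closedNeighborFinset G i, x j

/-- The pairs of equal or adjacent vertices, which index the terms of `localQuadraticForm`. -/
noncomputable def nearPairs (G : SimpleGraph ι) : Finset (Σ _ : ι, ι) :=
  Finset.univ.sigma (closedNeighborFinset G)

theorem localQuadraticForm_eq_sum_nearPairs (G : SimpleGraph ι) (x : ι → ℝ) :
    localQuadraticForm G x = ∑ p ∈ nearPairs G, x p.1 * x p.2 := by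
  simp only [localQuadraticForm, nearPairs, Finset.mul_sum, Finset.sum_sigma]

open Classical in
/-- The near pairs having an entry equal or adjacent to an entry of `p`: the only ones whose product
can be correlated with that of `p`. -/
noncomputable def touchingPairs (G : SimpleGraph ι) (p : Σ _ : ι, ι) : Finset (Σ _ : ι, ι) :=
  {q ∈ nearPairs G | ∃ k ∈ closedNeighborFinset G p.1 ∪ closedNeighborFinset G p.2,
    k = q.1 ∨ k = q.2}

section Card

variable {D : ℕ} (hD : ∀ i, (closedNeighborFinset G i).card ≤ D)
include hD

theorem card_nearPairs_le : (nearPairs G).card ≤ Fintype.card ι * D := by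
  rw [nearPairs, Finset.card_sigma]
  simpa using Finset.sum_le_card_nsmul Finset.univ _ D fun i _ => hD i

theorem card_touchingPairs_le (p : Σ _ : ι, ι) : (touchingPairs G p).card ≤ 4 * D ^ 2 := by
  classical
  set K := closedNeighborFinset G p.1 ∪ closedNeighborFinset G p.2
  have hK : K.card ≤ 2 * D := (Finset.card_union_le _ _).trans (by linarith [hD p.1, hD p.2])
  set P := K.sigma (closedNeighborFinset G)
  have hP : P.card ≤ 2 * D * D := by
    rw [Finset.card_sigma]
    refine (Finset.sum_le_card_nsmul K _ D fun i _ => hD i).trans ?_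
    rw [smul_eq_mul]
    gcongr
  have hsubset : touchingPairs G p ⊆ P ∪ P.image fun q => ⟨q.2, q.1⟩ := by
    rintro ⟨i, j⟩ hq
    simp only [touchingPairs, nearPairs, Finset.mem_filter, Finset.mem_sigma, Finset.mem_univ,
      true_and] at hq
    obtain ⟨hij, k, hk, rfl | rfl⟩ := hq
    · exact Finset.mem_union_left _ (Finset.mem_sigma.2 ⟨hk, hij⟩)
    · exact Finset.mem_union_right _ (Finset.mem_image.2
        ⟨⟨k, i⟩, Finset.mem_sigma.2 ⟨hk, mem_closedNeighborFinset_comm.1 hij⟩, rfl⟩)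
  calc (touchingPairs G p).card
      ≤ P.card + P.card := (Finset.card_le_card hsubset).trans
        ((Finset.card_union_le _ _).trans (Nat.add_le_add_left Finset.card_image_le _))
    _ ≤ 4 * D ^ 2 := by linarith

end Card

namespace IsDependencyGraph

variable {X : ι → Ω → ℝ} (h : IsDependencyGraph G X μ)
include h

theorem indepFun_of_notMem {i j : ι} (hij : j ∉ closedNeighborFinset G i) :
    IndepFun (X i) (X j) μ := by
  rw [mem_closedNeighborFinset, not_or] at hij
  exact (h.indepFun {i} {j} (by simpa using hij)).comp
    (measurable_pi_apply ⟨i, Finset.mem_singleton_self i⟩)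
    (measurable_pi_apply ⟨j, Finset.mem_singleton_self j⟩)

theorem indepFun_sum_sub_local_sum (i : ι) :
    IndepFun (X i) (fun ω => ∑ j, X j ω - ∑ j ∈ closedNeighborFinset G i, X j ω) μ := by
  classical
  have hfar : ∀ k ∈ ({i} : Finset ι), ∀ j ∈ (closedNeighborFinset G i)ᶜ, k ≠ j ∧ ¬G.Adj k j := by
    simp +contextual [mem_closedNeighborFinset]
  have hind := (h.indepFun _ _ hfar).comp
    (measurable_pi_apply ⟨i, Finset.mem_singleton_self i⟩)
    (Finset.measurable_fun_sum Finset.univ fun j _ => measurable_pi_apply j)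
  refine hind.congr .rfl (.of_forall fun ω => ?_)
  rw [Function.comp_apply, Finset.sum_coe_sort _ fun j => X j ω, eq_sub_iff_add_eq',
    Finset.sum_add_sum_compl]

theorem indepFun_mul_mul {p q : Σ _ : ι, ι} (hq : q ∈ nearPairs G) (hpq : q ∉ touchingPairs G p) :
    IndepFun (fun ω => X p.1 ω * X p.2 ω) (fun ω => X q.1 ω * X q.2 ω) μ := by
  classical
  have hfar : ∀ i ∈ ({p.1, p.2} : Finset ι), ∀ j ∈ ({q.1, q.2} : Finset ι),
      i ≠ j ∧ ¬G.Adj i j := by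
    simp only [touchingPairs, Finset.mem_filter, hq, true_and, Finset.mem_union,
      mem_closedNeighborFinset] at hpq
    grind
  exact (h.indepFun _ _ hfar).comp
    (φ := fun x : ({p.1, p.2} : Finset ι) → ℝ => x ⟨p.1, by simp⟩ * x ⟨p.2, by simp⟩)
    (ψ := fun x : ({q.1, q.2} : Finset ι) → ℝ => x ⟨q.1, by simp⟩ * x ⟨q.2, by simp⟩)
    (by fun_prop) (by fun_prop)

variable [IsProbabilityMeasure μ] {B : ℝ} (hB : ∀ i, ∀ᵐ ω ∂μ, |X i ω| ≤ B)
include hB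

theorem covariance_eq_zero_of_notMem {i j : ι} (hij : j ∉ closedNeighborFinset G i) :
    cov[X i, X j; μ] = 0 :=
  (h.indepFun_of_notMem hij).covariance_eq_zero (memLp_of_ae_abs_le (h.aemeasurable i) (hB i) 2)
    (memLp_of_ae_abs_le (h.aemeasurable j) (hB j) 2)

theorem variance_sum_eq_sum_covariance :
    Var[fun ω => ∑ i, X i ω; μ] = ∑ i, ∑ j ∈ closedNeighborFinset G i, cov[X i, X j; μ] := by
  rw [variance_fun_sum fun i => memLp_of_ae_abs_le (h.aemeasurable i) (hB i) 2]
  refine Finset.sum_congr rfl fun i _ => (Finset.sum_subset (Finset.subset_univ _) ?_).symm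
  exact fun j _ hj => h.covariance_eq_zero_of_notMem hB hj

theorem integral_localQuadraticForm (h0 : ∀ i, ∫ ω, X i ω ∂μ = 0) :
    ∫ ω, localQuadraticForm G (X · ω) ∂μ = Var[fun ω => ∑ i, X i ω; μ] := by
  have hL (i : ι) := memLp_of_ae_abs_le (h.aemeasurable i) (hB i) 2
  have hint (i j : ι) : Integrable (fun ω => X i ω * X j ω) μ := (hL i).integrable_mul (hL j)
  simp only [localQuadraticForm, Finset.mul_sum]
  rw [h.variance_sum_eq_sum_covariance hB,
    integral_finsetSum _ fun i _ => integrable_finsetSum _ fun j _ => hint i j]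
  refine Finset.sum_congr rfl fun i _ => ?_
  rw [integral_finsetSum _ fun j _ => hint i j]
  refine Finset.sum_congr rfl fun j _ => ?_
  rw [covariance_eq_sub (hL i) (hL j), h0, zero_mul, sub_zero]
  rfl

variable {D : ℕ} (hD : ∀ i, (closedNeighborFinset G i).card ≤ D)
include hD

theorem variance_sum_le : Var[fun ω => ∑ i, X i ω; μ] ≤ Fintype.card ι * D * B ^ 2 := by
  simpa using variance_sum_le_of_covariance_eq_zero (s := Finset.univ) (X := X)
    (fun i _ => h.aemeasurable i) (fun i _ => hB i)
    (fun i _ j _ hij => h.covariance_eq_zero_of_notMem hB hij) (fun i _ => hD i)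

theorem variance_localQuadraticForm_le :
    Var[fun ω => localQuadraticForm G (X · ω); μ] ≤ 4 * Fintype.card ι * D ^ 3 * B ^ 4 := by
  have hmeas (p : Σ _ : ι, ι) : AEMeasurable (fun ω => X p.1 ω * X p.2 ω) μ :=
    (h.aemeasurable p.1).mul (h.aemeasurable p.2)
  have hbound (p : Σ _ : ι, ι) : ∀ᵐ ω ∂μ, |X p.1 ω * X p.2 ω| ≤ B ^ 2 := by
    filter_upwards [hB p.1, hB p.2] with ω h₁ h₂
    rw [abs_mul, sq]
    gcongr
    exact (abs_nonneg _).trans h₁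
  have hcov : ∀ p ∈ nearPairs G, ∀ q ∈ nearPairs G, q ∉ touchingPairs G p →
      cov[fun ω => X p.1 ω * X p.2 ω, fun ω => X q.1 ω * X q.2 ω; μ] = 0 :=
    fun p _ q hq hpq => (h.indepFun_mul_mul hq hpq).covariance_eq_zero
      (memLp_of_ae_abs_le (hmeas p) (hbound p) 2) (memLp_of_ae_abs_le (hmeas q) (hbound q) 2)
  calc Var[fun ω => localQuadraticForm G (X · ω); μ]
      = Var[fun ω => ∑ p ∈ nearPairs G, X p.1 ω * X p.2 ω; μ] := by
        simp only [localQuadraticForm_eq_sum_nearPairs]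
    _ ≤ (nearPairs G).card * (4 * D ^ 2 : ℕ) * (B ^ 2) ^ 2 :=
        variance_sum_le_of_covariance_eq_zero (fun p _ => hmeas p) (fun p _ => hbound p) hcov
          fun p _ => card_touchingPairs_le hD p
    _ ≤ (Fintype.card ι * D : ℕ) * (4 * D ^ 2 : ℕ) * (B ^ 2) ^ 2 := by
        gcongr
        exact card_nearPairs_le hD
    _ = 4 * Fintype.card ι * D ^ 3 * B ^ 4 := by
        push_cast
        ring

end IsDependencyGraph

end DependencyGraphs

namespace IsDependencyGraph

section Stein

variable {ι Ω : Type*} [Fintype ι] [MeasurableSpace Ω] {μ : Measure Ω}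
  {G : SimpleGraph ι} {X : ι → Ω → ℝ} (h : IsDependencyGraph G X μ)
  {B : ℝ} (hB : ∀ i, ∀ᵐ ω ∂μ, |X i ω| ≤ B)
  {D : ℕ} (hD : ∀ i, (closedNeighborFinset G i).card ≤ D)

include hB hD in
theorem ae_abs_local_sum_le (i : ι) :
    ∀ᵐ ω ∂μ, |∑ j ∈ closedNeighborFinset G i, X j ω| ≤ D * B := by
  filter_upwards [ae_all_iff.2 hB] with ω hω
  calc |∑ j ∈ closedNeighborFinset G i, X j ω|
      ≤ (closedNeighborFinset G i).card * B := by
        simpa using (Finset.abs_sum_le_sum_abs _ _).trans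
          (Finset.sum_le_card_nsmul _ _ B fun j _ => hω j)
    _ ≤ D * B := by
        gcongr
        · exact (abs_nonneg _).trans (hω i)
        · exact hD i

variable [IsProbabilityMeasure μ]
include h hB

theorem memLp_localQuadraticForm : MemLp (fun ω => localQuadraticForm G (X · ω)) 2 μ :=
  memLp_finsetSum _ fun i _ =>
    (memLp_finsetSum _ fun j _ => memLp_of_ae_abs_le (h.aemeasurable j) (hB j) 2).mul
      (memLp_of_ae_abs_le (h.aemeasurable i) (hB i) ⊤)

include hD

-- Splitting `W = V + L` at each vertex, where `L` is the sum over the neighbours, the term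
-- `X i * exp (itV)` has mean zero and `exp (itL)` is expanded to first order.
theorem norm_integral_sum_mul_cexp_sub_le (h0 : ∀ i, ∫ ω, X i ω ∂μ = 0) (t : ℝ) :
    ‖(∫ ω, (∑ i, X i ω : ℝ) * Complex.exp (t * (∑ i, X i ω : ℝ) * Complex.I) ∂μ) -
      t * Complex.I * ∫ ω, localQuadraticForm G (X · ω) *
        Complex.exp (t * (∑ i, X i ω : ℝ) * Complex.I) ∂μ‖ ≤
      2 * t ^ 2 * (Fintype.card ι * D ^ 2 * B ^ 3) := by
  set L : ι → Ω → ℝ := fun i ω => ∑ j ∈ closedNeighborFinset G i, X j ω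
  have hW := h.aemeasurable_sum Finset.univ
  have hX (i : ι) := memLp_one_iff_integrable.1 (memLp_of_ae_abs_le (h.aemeasurable i) (hB i) 1)
  have hL (i : ι) : AEMeasurable (L i) μ := h.aemeasurable_sum _
  have hLB (i : ι) : ∀ᵐ ω ∂μ, |L i ω| ≤ D * B := ae_abs_local_sum_le hB hD i
  have hXL (i : ι) : Integrable (fun ω => X i ω * L i ω) μ :=
    (hX i).mul_bdd (hL i).aestronglyMeasurable (hLB i)
  have hlocal (i : ι) := norm_integral_mul_cexp_sub_le (h.indepFun_sum_sub_local_sum i)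
    (h.aemeasurable i) hW (hL i) (h0 i) (hB i) (hLB i) t
  have hsplit : (∫ ω, (∑ i, X i ω : ℝ) * Complex.exp (t * (∑ i, X i ω : ℝ) * Complex.I) ∂μ) -
      t * Complex.I * ∫ ω, localQuadraticForm G (X · ω) *
        Complex.exp (t * (∑ i, X i ω : ℝ) * Complex.I) ∂μ =
      ∑ i, ((∫ ω, X i ω * Complex.exp (t * (∑ i, X i ω : ℝ) * Complex.I) ∂μ) -
        t * Complex.I * ∫ ω, (X i ω * L i ω : ℝ) *
          Complex.exp (t * (∑ i, X i ω : ℝ) * Complex.I) ∂μ) := by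
    rw [Finset.sum_sub_distrib, ← Finset.mul_sum,
      ← integral_finsetSum _ fun i _ => integrable_mul_cexp (hX i) hW t,
      ← integral_finsetSum _ fun i _ => integrable_mul_cexp (hXL i) hW t]
    simp only [localQuadraticForm, Complex.ofReal_sum, Finset.sum_mul]
    rfl
  rw [hsplit]
  refine (norm_sum_le _ _).trans ((Finset.sum_le_card_nsmul _ _ _ fun i _ => hlocal i).trans ?_)
  rw [Finset.card_univ, nsmul_eq_mul]
  exact le_of_eq (by ring)

theorem integral_abs_localQuadraticForm_sub_one_le (h0 : ∀ i, ∫ ω, X i ω ∂μ = 0)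
    (h1 : Var[fun ω => ∑ i, X i ω; μ] = 1) :
    ∫ ω, |localQuadraticForm G (X · ω) - 1| ∂μ ≤ 2 * (Fintype.card ι * D ^ 2 * B ^ 3) := by
  have hone : 1 ≤ Fintype.card ι * D * B ^ 2 := h1 ▸ h.variance_sum_le hB hD
  have hB0 : 0 ≤ B := by
    rcases isEmpty_or_nonempty ι with _ | ⟨⟨i⟩⟩
    · norm_num at hone
    · exact nonneg_of_ae_abs_le (hB i)
  have hmean := h.integral_localQuadraticForm hB h0
  rw [h1] at hmean
  calc ∫ ω, |localQuadraticForm G (X · ω) - 1| ∂μ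
      ≤ √Var[fun ω => localQuadraticForm G (X · ω); μ] := by
        simpa only [hmean] using
          integral_abs_sub_integral_le_sqrt_variance (h.memLp_localQuadraticForm hB)
    _ ≤ √(4 * Fintype.card ι * D ^ 3 * B ^ 4 * 1) := by
        rw [mul_one]
        exact Real.sqrt_le_sqrt (h.variance_localQuadraticForm_le hB hD)
    _ ≤ √(4 * Fintype.card ι * D ^ 3 * B ^ 4 * (Fintype.card ι * D * B ^ 2)) := by gcongr
    _ = 2 * (Fintype.card ι * D ^ 2 * B ^ 3) := by
        rw [← Real.sqrt_sq (show 0 ≤ 2 * (Fintype.card ι * D ^ 2 * B ^ 3) by positivity)]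
        ring_nf

theorem norm_stein_le (h0 : ∀ i, ∫ ω, X i ω ∂μ = 0) (h1 : Var[fun ω => ∑ i, X i ω; μ] = 1)
    (t : ℝ) :
    ‖(∫ ω, (∑ i, X i ω : ℝ) * Complex.exp (t * (∑ i, X i ω : ℝ) * Complex.I) ∂μ) -
      t * Complex.I * ∫ ω, Complex.exp (t * (∑ i, X i ω : ℝ) * Complex.I) ∂μ‖ ≤
      2 * (t ^ 2 + |t|) * (Fintype.card ι * D ^ 2 * B ^ 3) := by
  set W : Ω → ℝ := fun ω => ∑ i, X i ω
  set Q : Ω → ℝ := fun ω => localQuadraticForm G (X · ω)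
  set e : Ω → ℂ := fun ω => Complex.exp (t * W ω * Complex.I)
  have hW : AEMeasurable W μ := h.aemeasurable_sum Finset.univ
  have hQ : Integrable Q μ := (h.memLp_localQuadraticForm hB).integrable (by norm_num)
  have hQ1 : Integrable (fun ω => Q ω - 1) μ := hQ.sub (integrable_const 1)
  have hnorm (ω : Ω) : ‖(Q ω - 1 : ℝ) * e ω‖ = |Q ω - 1| := by
    have := Complex.norm_exp_ofReal_mul_I (t * W ω)
    rw [Complex.ofReal_mul] at this
    rw [norm_mul, this, mul_one, Complex.norm_real, Real.norm_eq_abs]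
  have hfluct : ‖∫ ω, (Q ω - 1 : ℝ) * e ω ∂μ‖ ≤ 2 * (Fintype.card ι * D ^ 2 * B ^ 3) :=
    (norm_integral_le_of_norm_le hQ1.abs (.of_forall fun ω => (hnorm ω).le)).trans
      (h.integral_abs_localQuadraticForm_sub_one_le hB hD h0 h1)
  have hsplit : ∫ ω, e ω ∂μ = (∫ ω, Q ω * e ω ∂μ) - ∫ ω, (Q ω - 1 : ℝ) * e ω ∂μ := by
    rw [← integral_sub (integrable_mul_cexp hQ hW t) (integrable_mul_cexp hQ1 hW t)]
    congr with ω
    push_cast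
    ring
  calc ‖(∫ ω, W ω * e ω ∂μ) - t * Complex.I * ∫ ω, e ω ∂μ‖
      = ‖((∫ ω, W ω * e ω ∂μ) - t * Complex.I * ∫ ω, Q ω * e ω ∂μ) +
          t * Complex.I * ∫ ω, (Q ω - 1 : ℝ) * e ω ∂μ‖ := by
        rw [hsplit, mul_sub, sub_add]
    _ ≤ 2 * t ^ 2 * (Fintype.card ι * D ^ 2 * B ^ 3) +
          |t| * (2 * (Fintype.card ι * D ^ 2 * B ^ 3)) := by
        refine norm_add_le_of_le (h.norm_integral_sum_mul_cexp_sub_le hB hD h0 t) ?_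
        rw [norm_mul, norm_mul, Complex.norm_I, mul_one, Complex.norm_real, Real.norm_eq_abs]
        gcongr
    _ = 2 * (t ^ 2 + |t|) * (Fintype.card ι * D ^ 2 * B ^ 3) := by ring

theorem norm_charFun_map_sum_sub_le (h0 : ∀ i, ∫ ω, X i ω ∂μ = 0)
    (h1 : Var[fun ω => ∑ i, X i ω; μ] = 1) (t : ℝ) :
    ‖charFun (μ.map fun ω => ∑ i, X i ω) t - Complex.exp (-(t ^ 2 / 2))‖ ≤
      2 * |t| * (t ^ 2 + |t|) * (Fintype.card ι * D ^ 2 * B ^ 3) := by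
  have hW : MemLp (fun ω => ∑ i, X i ω) 1 μ :=
    memLp_finsetSum _ fun i _ => memLp_of_ae_abs_le (h.aemeasurable i) (hB i) 1
  have hnonneg : 0 ≤ Fintype.card ι * D ^ 2 * B ^ 3 := by
    have := (integral_nonneg fun ω => abs_nonneg _).trans
      (h.integral_abs_localQuadraticForm_sub_one_le hB hD h0 h1)
    linarith
  have hstein : ∀ s : ℝ, |s| ≤ |t| → 2 * (s ^ 2 + |s|) * (Fintype.card ι * D ^ 2 * B ^ 3) ≤
      2 * (t ^ 2 + |t|) * (Fintype.card ι * D ^ 2 * B ^ 3) := fun s hs => by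
    have := sq_le_sq.2 hs
    gcongr
  exact (norm_charFun_map_sub_le_of_stein hW fun s hs =>
    (h.norm_stein_le hB hD h0 h1 s).trans (hstein s hs)).trans_eq (by ring)

theorem norm_charFun_standardized_sum_sub_le (hσ : 0 < Var[fun ω => ∑ i, X i ω; μ]) (t : ℝ) :
    ‖charFun (μ.map fun ω => (∑ i, X i ω - ∫ ω', ∑ i, X i ω' ∂μ) /
      √Var[fun ω => ∑ i, X i ω; μ]) t - Complex.exp (-(t ^ 2 / 2))‖ ≤
      16 * |t| * (t ^ 2 + |t|) *
        (Fintype.card ι * D ^ 2 * B ^ 3 / √Var[fun ω => ∑ i, X i ω; μ] ^ 3) := by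
  set σ := √Var[fun ω => ∑ i, X i ω; μ]
  have hσ0 : 0 < σ := Real.sqrt_pos.2 hσ
  have hX (i : ι) : Integrable (X i) μ :=
    memLp_one_iff_integrable.1 (memLp_of_ae_abs_le (h.aemeasurable i) (hB i) 1)
  set X' : ι → Ω → ℝ := fun i ω => (X i ω - ∫ ω', X i ω' ∂μ) / σ
  have h' : IsDependencyGraph G X' μ :=
    h.comp (f := fun i x => (x - ∫ ω', X i ω' ∂μ) / σ) fun i => by fun_prop
  have hsum (ω : Ω) : ∑ i, X' i ω = (∑ i, X i ω - ∫ ω', ∑ i, X i ω' ∂μ) / σ := by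
    rw [integral_finsetSum _ fun i _ => hX i, ← Finset.sum_sub_distrib, Finset.sum_div]
  have hB' (i : ι) : ∀ᵐ ω ∂μ, |X' i ω| ≤ 2 * B / σ := by
    filter_upwards [hB i] with ω hω
    rw [abs_div, abs_of_pos hσ0]
    gcongr
    linarith [abs_sub (X i ω) (∫ ω', X i ω' ∂μ), abs_integral_le_of_ae_abs_le (hB i)]
  have h0 (i : ι) : ∫ ω, X' i ω ∂μ = 0 := by
    rw [integral_div, integral_sub (hX i) (integrable_const _)]
    simp
  have h1 : Var[fun ω => ∑ i, X' i ω; μ] = 1 := by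
    simp only [hsum, div_eq_inv_mul]
    rw [variance_const_mul, variance_sub_const (h.aemeasurable_sum _).aestronglyMeasurable,
      inv_pow, Real.sq_sqrt hσ.le, inv_mul_cancel₀ hσ.ne']
  simpa only [hsum] using (h'.norm_charFun_map_sum_sub_le hB' hD h0 h1 t).trans_eq (by ring)

end Stein

theorem tendstoInDistribution_standardized_sum {ι Ω : ℕ → Type*} [∀ n, Fintype (ι n)]
    [∀ n, MeasurableSpace (Ω n)] {μ : ∀ n, Measure (Ω n)} [∀ n, IsProbabilityMeasure (μ n)]
    {G : ∀ n, SimpleGraph (ι n)} {X : ∀ n, ι n → Ω n → ℝ}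
    (h : ∀ n, IsDependencyGraph (G n) (X n) (μ n))
    {B : ℕ → ℝ} (hB : ∀ n i, ∀ᵐ ω ∂μ n, |X n i ω| ≤ B n)
    {D : ℕ → ℕ} (hD : ∀ n i, (closedNeighborFinset (G n) i).card ≤ D n)
    (hσ : ∀ᶠ n in atTop, 0 < Var[fun ω => ∑ i, X n i ω; μ n])
    (hlim : Tendsto (fun n => Fintype.card (ι n) * D n ^ 2 * B n ^ 3 /
      √Var[fun ω => ∑ i, X n i ω; μ n] ^ 3) atTop (𝓝 0)) :
    TendstoInDistribution (fun n ω => (∑ i, X n i ω - ∫ ω', ∑ i, X n i ω' ∂μ n) /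
      √Var[fun ω => ∑ i, X n i ω; μ n]) atTop (id : ℝ → ℝ) μ (gaussianReal 0 1) := by
  refine ⟨fun n => (((h n).aemeasurable_sum _).sub_const _).div_const _, aemeasurable_id, ?_⟩
  refine ProbabilityMeasure.tendsto_iff_tendsto_charFun.2 fun t => ?_
  have hgauss : charFun ((gaussianReal 0 1).map (id : ℝ → ℝ)) t = Complex.exp (-(t ^ 2 / 2)) := by
    rw [Measure.map_id, charFun_gaussianReal]
    congr 1
    simp
  change Tendsto (fun n => charFun ((μ n).map fun ω => (∑ i, X n i ω - ∫ ω', ∑ i, X n i ω' ∂μ n) /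
    √Var[fun ω => ∑ i, X n i ω; μ n]) t) atTop (𝓝 (charFun ((gaussianReal 0 1).map id) t))
  rw [hgauss, tendsto_iff_norm_sub_tendsto_zero]
  refine squeeze_zero' (.of_forall fun _ => norm_nonneg _) (hσ.mono fun n hn =>
    (h n).norm_charFun_standardized_sum_sub_le (hB n) (hD n) hn t) ?_
  simpa using hlim.const_mul (16 * |t| * (t ^ 2 + |t|))

end IsDependencyGraph

section IntersectionGraphs

variable {ι κ : Type*}

/-- The intersection graph of a family of finite sets. It is a dependency graph for any functions
`X i` of independent coordinates such that `X i` only involves the coordinates in `S i`. -/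
def intersectionGraph (S : ι → Finset κ) : SimpleGraph ι where
  Adj i j := i ≠ j ∧ ¬Disjoint (S i) (S j)
  symm := ⟨fun _ _ h => ⟨h.1.symm, fun hd => h.2 hd.symm⟩⟩
  loopless := ⟨fun _ h => h.1 rfl⟩

theorem card_closedNeighborFinset_intersectionGraph_le [Fintype ι] [DecidableEq κ]
    {S : ι → Finset κ} (hS : ∀ i, (S i).Nonempty) {d e : ℕ} (hd : ∀ i, (S i).card ≤ d)
    (he : ∀ k, ({i | k ∈ S i} : Finset ι).card ≤ e) (i : ι) :
    (closedNeighborFinset (intersectionGraph S) i).card ≤ d * e := by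
  classical
  have hsubset : closedNeighborFinset (intersectionGraph S) i ⊆
      (S i).biUnion fun k => {j | k ∈ S j} := fun j hj => by
    rw [mem_closedNeighborFinset] at hj
    simp only [Finset.mem_biUnion, Finset.mem_filter, Finset.mem_univ, true_and]
    rcases hj with rfl | ⟨-, hij⟩
    · exact ⟨(hS i).choose, (hS i).choose_spec, (hS i).choose_spec⟩
    · exact Finset.not_disjoint_iff.1 hij
  exact (Finset.card_le_card hsubset).trans
    ((Finset.card_biUnion_le_card_mul _ _ _ fun k _ => he k).trans (Nat.mul_le_mul_right e (hd i)))

variable {α : κ → Type*}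

theorem comp_updateFinset_comp_restrict_of_dependsOn [DecidableEq κ] {β : Type*} {s : Finset κ}
    {f : (∀ k, α k) → β} (x₀ : ∀ k, α k) (hf : DependsOn f s) :
    (f ∘ Function.updateFinset x₀ s) ∘ s.restrict = f :=
  funext fun x => hf fun k hk => by simp [Function.updateFinset, Finset.mem_coe.1 hk]

variable [Fintype κ] [∀ k, MeasurableSpace (α k)] {μ : ∀ k, Measure (α k)}
  [∀ k, IsProbabilityMeasure (μ k)]

theorem indepFun_pi_of_dependsOn {E F : Type*} [MeasurableSpace E] [MeasurableSpace F]
    {s t : Finset κ} {f : (∀ k, α k) → E} {g : (∀ k, α k) → F} (hf : Measurable f)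
    (hg : Measurable g) (hfs : DependsOn f s) (hgt : DependsOn g t) (hst : Disjoint s t) :
    IndepFun f g (Measure.pi μ) := by
  classical
  have x₀ : ∀ k, α k := fun k => (nonempty_of_isProbabilityMeasure (μ k)).some
  have hcoord : iIndepFun (fun k (x : ∀ k, α k) => x k) (Measure.pi μ) :=
    iIndepFun_pi (X := fun _ => id) fun _ => aemeasurable_id
  rw [← comp_updateFinset_comp_restrict_of_dependsOn x₀ hfs,
    ← comp_updateFinset_comp_restrict_of_dependsOn x₀ hgt]
  exact (hcoord.indepFun_finset s t hst fun k => measurable_pi_apply k).comp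
    (hf.comp measurable_updateFinset) (hg.comp measurable_updateFinset)

theorem isDependencyGraph_intersectionGraph_pi {E : Type*} [MeasurableSpace E]
    {X : ι → (∀ k, α k) → E} {S : ι → Finset κ} (hX : ∀ i, Measurable (X i))
    (hS : ∀ i, DependsOn (X i) (S i)) :
    IsDependencyGraph (intersectionGraph S) X (Measure.pi μ) where
  aemeasurable i := (hX i).aemeasurable
  indepFun s t hst := by
    classical
    have hdep (s : Finset ι) : DependsOn (fun x (i : s) => X i x) (s.biUnion S : Set κ) :=
      fun x y hxy => funext fun i => hS i fun k hk => hxy k (Finset.mem_coe.2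
        (Finset.mem_biUnion.2 ⟨i, i.2, hk⟩))
    refine indepFun_pi_of_dependsOn (s := s.biUnion S) (t := t.biUnion S) (by fun_prop)
      (by fun_prop) (hdep s) (hdep t) ?_
    rw [Finset.disjoint_biUnion_left]
    intro i hi
    rw [Finset.disjoint_biUnion_right]
    intro j hj
    by_contra hij
    exact (hst i hi j hj).2 ⟨(hst i hi j hj).1, hij⟩

end IntersectionGraphs

section TreatedSum

variable {R : Type*}

@[simp]
theorem bitVal_true : bitVal true = 1 := rfl

@[simp]
theorem bitVal_false : bitVal false = 0 := rfl

theorem bitVal_mul_self (b : Bool) : bitVal b * bitVal b = bitVal b := by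
  cases b <;> simp

theorem abs_bitVal_sub_le_one (b : Bool) (p : unitInterval) : |bitVal b - p| ≤ 1 := by
  have hp₀ := p.2.1
  have hp₁ := p.2.2
  cases b <;> rw [abs_le] <;> constructor <;> simp <;> linarith

/-- The total of the weights `v` over the treated units in `s`. Exposures and instruments are sums
of this form. -/
noncomputable def treatedSum (s : Finset R) (v : R → ℝ) (T : R → Bool) : ℝ :=
  ∑ r ∈ s, bitVal (T r) * v r

theorem dependsOn_treatedSum (s : Finset R) (v : R → ℝ) : DependsOn (treatedSum s v) s :=
  fun T T' h => Finset.sum_congr rfl fun r hr => by rw [h r hr]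

theorem treatedSum_true (s : Finset R) (v : R → ℝ) :
    treatedSum s v (fun _ => true) = ∑ r ∈ s, v r := by
  simp only [treatedSum, bitVal_true, one_mul]

theorem treatedSum_false (s : Finset R) (v : R → ℝ) : treatedSum s v (fun _ => false) = 0 := by
  simp only [treatedSum, bitVal_false, zero_mul, Finset.sum_const_zero]

theorem treatedSum_add_treatedSum_sdiff [DecidableEq R] {s t : Finset R} (hts : t ⊆ s)
    (v : R → ℝ) (T : R → Bool) :
    treatedSum t v T + treatedSum (s \ t) v T = treatedSum s v T := by
  rw [add_comm]
  exact Finset.sum_sdiff hts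

theorem abs_treatedSum_le (s : Finset R) (v : R → ℝ) (T : R → Bool) :
    |treatedSum s v T| ≤ ∑ r ∈ s, |v r| := by
  refine (Finset.abs_sum_le_sum_abs _ _).trans (Finset.sum_le_sum fun r _ => ?_)
  cases T r <;> simp

end TreatedSum

theorem abs_sum_mul_eq_of_sameSign {ι : Type*} {s : Finset ι} {w u : ι → ℝ}
    (hu : ∀ i ∈ s, 0 ≤ u i) (hw : ∀ i ∈ s, ∀ j ∈ s, u i ≠ 0 → u j ≠ 0 → 0 < w i * w j) :
    |∑ i ∈ s, w i * u i| = ∑ i ∈ s, |w i| * u i := by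
  by_cases hzero : ∀ i ∈ s, u i = 0
  · rw [Finset.sum_eq_zero fun i hi => by rw [hzero i hi, mul_zero],
      Finset.sum_eq_zero fun i hi => by rw [hzero i hi, mul_zero], abs_zero]
  push Not at hzero
  obtain ⟨j, hj, huj⟩ := hzero
  have habs : ∑ i ∈ s, |w i| * u i = SignType.sign (w j) * ∑ i ∈ s, w i * u i := by
    rw [Finset.mul_sum]
    refine Finset.sum_congr rfl fun i hi => ?_
    rcases eq_or_ne (u i) 0 with hui | hui
    · simp [hui]
    · rcases pos_and_pos_or_neg_and_neg_of_mul_pos (hw i hi j hj hui huj) with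
        ⟨hi, hj⟩ | ⟨hi, hj⟩
      · simp [abs_of_pos hi, sign_pos hj]
      · simp [abs_of_neg hi, sign_neg hj]
  have hnonneg : 0 ≤ ∑ i ∈ s, |w i| * u i :=
    Finset.sum_nonneg fun i hi => mul_nonneg (abs_nonneg _) (hu i hi)
  have hwj : w j ≠ 0 := fun h => by simpa [h] using hw j hj j hj huj huj
  rw [← abs_of_nonneg hnonneg, habs, abs_mul]
  rcases hwj.lt_or_gt with h | h
  · simp [sign_neg h]
  · simp [sign_pos h]

namespace BipartiteExperiment

section Law

variable {A R : Type*} [Fintype R] (X : BipartiteExperiment A R)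

theorem indepFun_law_of_dependsOn {E F : Type*} [MeasurableSpace E] [MeasurableSpace F]
    {s t : Finset R} {f : (R → Bool) → E} {g : (R → Bool) → F} (hfs : DependsOn f s)
    (hgt : DependsOn g t) (hst : Disjoint s t) : IndepFun f g X.law :=
  indepFun_pi_of_dependsOn .of_discrete .of_discrete hfs hgt hst

theorem integral_bitVal (r : R) : ∫ T, bitVal (T r) ∂X.law = X.p := by
  unfold law
  rw [integral_comp_eval (μ := fun _ : R => bernoulliMeasure true false X.p) (f := bitVal)
    .of_discrete, integral_bernoulliMeasure]
  simp

theorem covariance_bitVal [DecidableEq R] (r r' : R) :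
    cov[fun T : R → Bool => bitVal (T r), fun T => bitVal (T r'); X.law] =
      if r = r' then (X.p : ℝ) * (1 - X.p) else 0 := by
  split_ifs with h
  · subst h
    rw [covariance_eq_sub .of_discrete .of_discrete]
    simp only [Pi.mul_apply, bitVal_mul_self, integral_bitVal]
    ring
  · have hdep (k : R) : DependsOn (fun T : R → Bool => bitVal (T k)) ({k} : Finset R) :=
      fun T T' hT => congrArg bitVal (hT k (by simp))
    exact (X.indepFun_law_of_dependsOn (hdep r) (hdep r') (by simpa using h)).covariance_eq_zero
      .of_discrete .of_discrete

theorem integral_treatedSum (s : Finset R) (v : R → ℝ) :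
    ∫ T, treatedSum s v T ∂X.law = X.p * ∑ r ∈ s, v r := by
  simp only [treatedSum]
  rw [integral_finsetSum _ fun _ _ => .of_finite, Finset.mul_sum]
  simp only [integral_mul_const, integral_bitVal]

theorem covariance_treatedSum [DecidableEq R] (s t : Finset R) (v v' : R → ℝ) :
    cov[treatedSum s v, treatedSum t v'; X.law] =
      X.p * (1 - X.p) * ∑ r ∈ s ∩ t, v r * v' r := by
  change cov[fun T => ∑ r ∈ s, bitVal (T r) * v r, fun T => ∑ r ∈ t, bitVal (T r) * v' r; X.law] = _
  rw [covariance_fun_sum_fun_sum' (fun _ _ => .of_discrete) fun _ _ => .of_discrete]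
  simp only [covariance_mul_const_left, covariance_mul_const_right, covariance_bitVal, ite_mul,
    zero_mul, Finset.sum_ite_eq, Finset.sum_ite_mem, Finset.mul_sum, mul_assoc]

theorem abs_treatedSum_sub_integral_le (s : Finset R) {v : R → ℝ} (hv : ∀ r ∈ s, 0 ≤ v r)
    (T : R → Bool) :
    |treatedSum s v T - ∫ T', treatedSum s v T' ∂X.law| ≤ ∑ r ∈ s, v r := by
  rw [integral_treatedSum, treatedSum, Finset.mul_sum, ← Finset.sum_sub_distrib]
  refine (Finset.abs_sum_le_sum_abs _ _).trans (Finset.sum_le_sum fun r hr => ?_)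
  rw [← sub_mul, abs_mul, abs_of_nonneg (hv r hr)]
  exact mul_le_of_le_one_left (hv r hr) (abs_bitVal_sub_le_one _ _)

end Law

noncomputable section

section Decomposition

variable {A R : Type*} [Fintype R] (X : BipartiteExperiment A R)

open Classical in
/-- The randomization units joined to `a` by an edge of the candidate anchor subgraph `G`. -/
def anchorUnits (a : A) : Finset R := {r | (a, r) ∈ X.G}

/-- The contribution of `a` to the estimator `muHat`, an estimator of `Y_a(1) - Y_a(0)`. -/
def effectHat (a : A) (T : R → Bool) : ℝ := X.betaHat a T * X.weightHat a T

variable {X}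

theorem mem_anchorUnits {a : A} {r : R} : r ∈ X.anchorUnits a ↔ (a, r) ∈ X.G := by
  simp [anchorUnits]

theorem mem_unitsOf {a : A} {r : R} : r ∈ X.unitsOf a ↔ X.E a r (fun _ => true) = true := by
  simp [unitsOf]

theorem IsAnchor.anchorUnits_subset_unitsOf (h : X.IsAnchor) (a : A) :
    X.anchorUnits a ⊆ X.unitsOf a :=
  fun r hr => mem_unitsOf.2 (h a r (mem_anchorUnits.1 hr) _)

theorem RDriven.bitVal_mul_bitVal [DecidableEq R] (h : X.RDriven) (a : A) (r : R)
    (T : R → Bool) :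
    bitVal (T r) * bitVal (X.E a r T) = if r ∈ X.unitsOf a then bitVal (T r) else 0 := by
  cases hT : T r
  · simp
  · rw [h a r T (fun _ => true) hT, bitVal_true, one_mul]
    simp only [bitVal, mem_unitsOf]

theorem RDriven.exposure_eq_treatedSum (h : X.RDriven) (a : A) :
    X.exposure a = treatedSum (X.unitsOf a) (X.w a) := by
  classical
  ext T
  simp only [exposure, treatedSum, h.bitVal_mul_bitVal, ite_mul, zero_mul, Finset.sum_ite_mem,
    Finset.univ_inter]

namespace BasicAssumptions

theorem instrument_eq_treatedSum (h : X.BasicAssumptions) (a : A) :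
    X.instrument a = treatedSum (X.anchorUnits a) (X.u a) := by
  ext T
  refine (Finset.sum_subset (Finset.subset_univ _) fun r _ hr => ?_).symm
  rw [of_not_not fun hu => hr (mem_anchorUnits.2 (h.u_support a r hu)), mul_zero]

theorem weightHat_eq_add_treatedSum [DecidableEq R] (h : X.BasicAssumptions) (a : A)
    (T : R → Bool) :
    X.weightHat a T = ∑ r ∈ X.anchorUnits a, X.w a r +
      treatedSum (X.unitsOf a \ X.anchorUnits a) (X.w a) T / X.p := by
  have hterm (r : R) :
      bitVal (T r) * X.w a r * (bitVal (X.E a r T) - X.c a r) / (X.p : ℝ) + X.w a r * X.c a r =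
        (if r ∈ X.anchorUnits a then X.w a r else 0) +
          (if r ∈ X.unitsOf a \ X.anchorUnits a then bitVal (T r) * X.w a r else 0) / X.p := by
    rw [h.c_eq]
    by_cases hG : (a, r) ∈ X.G
    · simp [mem_anchorUnits, hG, h.anchor a r hG T]
    · have hE := h.rDriven.bitVal_mul_bitVal a r T
      simp only [mem_anchorUnits, hG, Set.indicator_of_notMem, not_false_eq_true, sub_zero,
        mul_zero, add_zero, zero_add, if_false, Finset.mem_sdiff, and_true]
      rw [mul_right_comm, hE, ite_mul, zero_mul]
  simp only [weightHat, hterm, Finset.sum_add_distrib, ← Finset.sum_div, Finset.sum_ite_mem,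
    Finset.univ_inter, treatedSum]

theorem dependsOn_effectHat (h : X.BasicAssumptions) (a : A) :
    DependsOn (X.effectHat a) (X.unitsOf a) := by
  classical
  obtain ⟨α, β, hY⟩ := h.linear
  intro T T' hT
  have hx : X.exposure a T = X.exposure a T' := by
    rw [h.rDriven.exposure_eq_treatedSum]
    exact dependsOn_treatedSum _ _ hT
  have hz : X.instrument a T = X.instrument a T' := by
    rw [h.instrument_eq_treatedSum]
    exact dependsOn_treatedSum _ _ fun r hr => hT r (h.anchor.anchorUnits_subset_unitsOf a hr)
  have hw : X.weightHat a T = X.weightHat a T' := by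
    simp only [h.weightHat_eq_add_treatedSum]
    rw [dependsOn_treatedSum _ _ fun r hr => hT r (Finset.sdiff_subset hr)]
  simp only [effectHat, betaHat, hY, hx, hz, hw]

theorem covariance_exposure_instrument (h : X.BasicAssumptions) (a : A) :
    cov[X.exposure a, X.instrument a; X.law] =
      X.p * (1 - X.p) * ∑ r ∈ X.anchorUnits a, X.w a r * X.u a r := by
  classical
  rw [h.rDriven.exposure_eq_treatedSum, h.instrument_eq_treatedSum, covariance_treatedSum,
    Finset.inter_eq_right.2 (h.anchor.anchorUnits_subset_unitsOf a)]

theorem integral_weightHat (h : X.BasicAssumptions) (a : A) :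
    ∫ T, X.weightHat a T ∂X.law = ∑ r ∈ X.unitsOf a, X.w a r := by
  classical
  simp only [h.weightHat_eq_add_treatedSum]
  rw [integral_add .of_finite .of_finite, integral_const, probReal_univ, one_smul, integral_div,
    integral_treatedSum, mul_div_cancel_left₀ _ h.p_pos.ne', add_comm,
    Finset.sum_sdiff (h.anchor.anchorUnits_subset_unitsOf a)]

theorem indepFun_anchor_nonanchor [DecidableEq R] (h : X.BasicAssumptions) (a : A) :
    IndepFun (fun T => (treatedSum (X.anchorUnits a) (X.w a) T, X.instrument a T))
      (fun T => (treatedSum (X.unitsOf a \ X.anchorUnits a) (X.w a) T, X.weightHat a T))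
      X.law := by
  refine X.indepFun_law_of_dependsOn (s := X.anchorUnits a) (t := X.unitsOf a \ X.anchorUnits a)
    (fun T T' hT => ?_) (fun T T' hT => ?_) Finset.disjoint_sdiff
  · rw [h.instrument_eq_treatedSum, dependsOn_treatedSum _ (X.w a) hT,
      dependsOn_treatedSum _ (X.u a) hT]
  · simp only [h.weightHat_eq_add_treatedSum, dependsOn_treatedSum _ (X.w a) hT]

theorem integral_effectHat (h : X.BasicAssumptions) {a : A}
    (hcov : cov[X.exposure a, X.instrument a; X.law] ≠ 0) :
    ∫ T, X.effectHat a T ∂X.law = X.Y a (fun _ => true) - X.Y a (fun _ => false) := by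
  classical
  obtain ⟨α, β, hY⟩ := h.linear
  set x₀ := treatedSum (X.anchorUnits a) (X.w a)
  set x₁ := treatedSum (X.unitsOf a \ X.anchorUnits a) (X.w a)
  set γ := cov[X.exposure a, X.instrument a; X.law] with hγ
  have hx (T : R → Bool) : X.exposure a T = x₀ T + x₁ T := by
    rw [h.rDriven.exposure_eq_treatedSum, treatedSum_add_treatedSum_sdiff
      (h.anchor.anchorUnits_subset_unitsOf a)]
  have hcov₀ : cov[x₀, X.instrument a; X.law] = γ := by
    rw [hγ, h.covariance_exposure_instrument, h.instrument_eq_treatedSum, covariance_treatedSum,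
      Finset.inter_self]
  have heffect (T : R → Bool) : X.effectHat a T = γ⁻¹ * ((α a + β a * (x₀ T + x₁ T)) *
      (X.instrument a T - ∫ T', X.instrument a T' ∂X.law) * X.weightHat a T) := by
    rw [effectHat, betaHat, hY, hx]
    ring
  calc ∫ T, X.effectHat a T ∂X.law
      = γ⁻¹ * (β a * γ * ∑ r ∈ X.unitsOf a, X.w a r) := by
        simp only [heffect]
        rw [integral_const_mul, integral_affine_mul_centered_mul_of_indepFun .of_discrete
          .of_discrete .of_finite .of_finite (h.indepFun_anchor_nonanchor a), hcov₀,
          h.integral_weightHat]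
    _ = β a * ∑ r ∈ X.unitsOf a, X.w a r := by field_simp
    _ = X.Y a (fun _ => true) - X.Y a (fun _ => false) := by
        rw [hY, hY, h.rDriven.exposure_eq_treatedSum, treatedSum_true, treatedSum_false]
        ring

theorem card_unitsOf_pos (h : X.BasicAssumptions) (a : A) : 0 < (X.unitsOf a).card := by
  obtain ⟨r, hr⟩ := h.u_nontrivial a
  exact Finset.card_pos.2
    ⟨r, h.anchor.anchorUnits_subset_unitsOf a (mem_anchorUnits.2 (h.u_support a r hr))⟩

theorem isDependencyGraph_mul_effectHat (h : X.BasicAssumptions) (b : ℝ) :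
    IsDependencyGraph (intersectionGraph X.unitsOf) (fun a T => b * X.effectHat a T) X.law :=
  isDependencyGraph_intersectionGraph_pi (fun _ => .of_discrete)
    fun a _ _ hT => congrArg (b * ·) (h.dependsOn_effectHat a hT)

end BasicAssumptions

end Decomposition

end

end BipartiteExperiment

namespace BipartiteExperiment

namespace AsymptoticAssumptions

section Bounds

variable {A R : Type*} [Fintype R] {X : BipartiteExperiment A R} {δ Wl Wh M : ℝ}

theorem sum_abs_weight_le (h : X.AsymptoticAssumptions δ Wl Wh M) (a : A) :
    ∑ r ∈ X.unitsOf a, |X.w a r| ≤ Wh := by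
  have hcard : ((X.unitsOf a).card : ℝ) ≠ 0 := mod_cast (h.card_unitsOf_pos a).ne'
  calc ∑ r ∈ X.unitsOf a, |X.w a r| ≤ (X.unitsOf a).card • (Wh / (X.unitsOf a).card) :=
        Finset.sum_le_card_nsmul _ _ _ (h.w_upper a)
    _ = Wh := by rw [nsmul_eq_mul, mul_div_cancel₀ _ hcard]

theorem abs_weightHat_le (h : X.AsymptoticAssumptions δ Wl Wh M) (hδ : 0 < δ) (a : A)
    (T : R → Bool) : |X.weightHat a T| ≤ Wh / δ := by
  classical
  have hp : 0 < (X.p : ℝ) := h.p_pos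
  have hanchor : |∑ r ∈ X.anchorUnits a, X.w a r| ≤ (∑ r ∈ X.anchorUnits a, |X.w a r|) / X.p :=
    (Finset.abs_sum_le_sum_abs _ _).trans
      (le_div_self (Finset.sum_nonneg fun _ _ => abs_nonneg _) hp h.p_lt_one.le)
  have hrest : |treatedSum (X.unitsOf a \ X.anchorUnits a) (X.w a) T / X.p| ≤
      (∑ r ∈ X.unitsOf a \ X.anchorUnits a, |X.w a r|) / X.p := by
    rw [abs_div, abs_of_pos hp]
    gcongr
    exact abs_treatedSum_le _ _ _
  calc |X.weightHat a T|
      ≤ (∑ r ∈ X.anchorUnits a, |X.w a r|) / X.p +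
          (∑ r ∈ X.unitsOf a \ X.anchorUnits a, |X.w a r|) / X.p := by
        rw [h.weightHat_eq_add_treatedSum]
        exact (abs_add_le _ _).trans (add_le_add hanchor hrest)
    _ = (∑ r ∈ X.unitsOf a, |X.w a r|) / X.p := by
        rw [← add_div, add_comm, Finset.sum_sdiff (h.anchor.anchorUnits_subset_unitsOf a)]
    _ ≤ Wh / δ := div_le_div₀ ((Finset.sum_nonneg fun _ _ => abs_nonneg _).trans
        (h.sum_abs_weight_le a)) (h.sum_abs_weight_le a) hδ h.p_lower

theorem sum_instrumentWeight_pos (h : X.AsymptoticAssumptions δ Wl Wh M) (a : A) :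
    0 < ∑ r ∈ X.anchorUnits a, X.u a r := by
  obtain ⟨r, hr⟩ := h.u_nontrivial a
  exact Finset.sum_pos' (fun r _ => h.u_nonneg a r)
    ⟨r, mem_anchorUnits.2 (h.u_support a r hr), (h.u_nonneg a r).lt_of_ne' hr⟩

theorem le_abs_covariance_exposure_instrument (h : X.AsymptoticAssumptions δ Wl Wh M)
    (hδ : 0 < δ) (hWl : 0 < Wl) (a : A) :
    δ ^ 2 * (Wl / (X.unitsOf a).card * ∑ r ∈ X.anchorUnits a, X.u a r) ≤
      |cov[X.exposure a, X.instrument a; X.law]| := by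
  have hsum := h.sum_instrumentWeight_pos a
  have hp : δ ^ 2 ≤ |(X.p : ℝ) * (1 - X.p)| := by
    rw [sq]
    exact (mul_le_mul h.p_lower h.p_upper hδ.le h.p_pos.le).trans (le_abs_self _)
  have hweights : Wl / (X.unitsOf a).card * ∑ r ∈ X.anchorUnits a, X.u a r ≤
      |∑ r ∈ X.anchorUnits a, X.w a r * X.u a r| := by
    rw [abs_sum_mul_eq_of_sameSign (fun r _ => h.u_nonneg a r)
      fun r _ r' _ => h.same_sign a r r', Finset.mul_sum]
    exact Finset.sum_le_sum fun r hr => mul_le_mul_of_nonneg_right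
      (h.w_lower a r (h.anchor.anchorUnits_subset_unitsOf a hr)) (h.u_nonneg a r)
  rw [h.covariance_exposure_instrument, abs_mul]
  exact mul_le_mul hp hweights (by positivity) (abs_nonneg _)

theorem abs_covariance_exposure_instrument_pos (h : X.AsymptoticAssumptions δ Wl Wh M)
    (hδ : 0 < δ) (hWl : 0 < Wl) (a : A) : 0 < |cov[X.exposure a, X.instrument a; X.law]| := by
  have hsum := h.sum_instrumentWeight_pos a
  have hcard : (0 : ℝ) < (X.unitsOf a).card := mod_cast h.card_unitsOf_pos a
  exact lt_of_lt_of_le (by positivity) (h.le_abs_covariance_exposure_instrument hδ hWl a)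

theorem abs_betaHat_le (h : X.AsymptoticAssumptions δ Wl Wh M) (hδ : 0 < δ) (hWl : 0 < Wl)
    (a : A) (T : R → Bool) :
    |X.betaHat a T| ≤ M / (δ ^ 2 * Wl) * (X.unitsOf a).card := by
  have hsum := h.sum_instrumentWeight_pos a
  have hcard : (0 : ℝ) < (X.unitsOf a).card := mod_cast h.card_unitsOf_pos a
  have hM : 0 ≤ M := (abs_nonneg _).trans (h.bounded a T)
  have hcentered : |X.instrument a T - ∫ T', X.instrument a T' ∂X.law| ≤
      ∑ r ∈ X.anchorUnits a, X.u a r := by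
    rw [h.instrument_eq_treatedSum]
    exact X.abs_treatedSum_sub_integral_le _ (fun r _ => h.u_nonneg a r) T
  calc |X.betaHat a T|
      ≤ M * (∑ r ∈ X.anchorUnits a, X.u a r) /
          (δ ^ 2 * (Wl / (X.unitsOf a).card * ∑ r ∈ X.anchorUnits a, X.u a r)) := by
        rw [betaHat, abs_div, abs_mul]
        exact div_le_div₀ (by positivity)
          (mul_le_mul (h.bounded a T) hcentered (abs_nonneg _) hM) (by positivity)
          (h.le_abs_covariance_exposure_instrument hδ hWl a)
    _ = M / (δ ^ 2 * Wl) * (X.unitsOf a).card := by field_simp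

end Bounds

section Aggregate

variable {A R : Type*} [Fintype A] [Fintype R] {X : BipartiteExperiment A R} {δ Wl Wh M : ℝ}

theorem abs_effectHat_le (h : X.AsymptoticAssumptions δ Wl Wh M) (hδ : 0 < δ) (hWl : 0 < Wl)
    (a : A) (T : R → Bool) : |X.effectHat a T| ≤ M * Wh / (δ ^ 3 * Wl) * X.degA := by
  have hM : 0 ≤ M := (abs_nonneg _).trans (h.bounded a T)
  have hWh : 0 ≤ Wh := (Finset.sum_nonneg fun _ _ => abs_nonneg _).trans (h.sum_abs_weight_le a)
  have hdeg : ((X.unitsOf a).card : ℝ) ≤ X.degA :=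
    mod_cast Finset.le_sup (f := fun a => (X.unitsOf a).card) (Finset.mem_univ a)
  calc |X.effectHat a T| ≤ M / (δ ^ 2 * Wl) * (X.unitsOf a).card * (Wh / δ) := by
        rw [effectHat, abs_mul]
        exact mul_le_mul (h.abs_betaHat_le hδ hWl a T) (h.abs_weightHat_le hδ a T)
          (abs_nonneg _) (by positivity)
    _ = M * Wh / (δ ^ 3 * Wl) * (X.unitsOf a).card := by field_simp
    _ ≤ M * Wh / (δ ^ 3 * Wl) * X.degA := by gcongr

theorem card_closedNeighborFinset_le (h : X.AsymptoticAssumptions δ Wl Wh M) (a : A) :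
    (closedNeighborFinset (intersectionGraph X.unitsOf) a).card ≤ X.degA * X.degR := by
  classical
  refine card_closedNeighborFinset_intersectionGraph_le
    (fun a => Finset.card_pos.1 (h.card_unitsOf_pos a))
    (fun a => Finset.le_sup (f := fun a => (X.unitsOf a).card) (Finset.mem_univ a))
    (fun r => ?_) a
  simp only [mem_unitsOf]
  exact Finset.le_sup (f := fun r => (X.analysisOf r).card) (Finset.mem_univ r)

end Aggregate

end AsymptoticAssumptions

section Estimator

variable {A R : Type*} [Fintype A] [Fintype R] {X : BipartiteExperiment A R} {δ Wl Wh M : ℝ}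

theorem sum_inv_card_mul_effectHat (X : BipartiteExperiment A R) (T : R → Bool) :
    ∑ a, 1 / (Fintype.card A : ℝ) * X.effectHat a T = X.muHat T :=
  (Finset.mul_sum _ _ _).symm

namespace AsymptoticAssumptions

theorem abs_inv_card_mul_effectHat_le (h : X.AsymptoticAssumptions δ Wl Wh M) (hδ : 0 < δ)
    (hWl : 0 < Wl) (a : A) (T : R → Bool) :
    |1 / (Fintype.card A : ℝ) * X.effectHat a T| ≤
      M * Wh / (δ ^ 3 * Wl) * X.degA / Fintype.card A := by
  rw [one_div_mul_eq_div, abs_div, Nat.abs_cast]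
  gcongr
  exact h.abs_effectHat_le hδ hWl a T

theorem integral_muHat (h : X.AsymptoticAssumptions δ Wl Wh M) (hδ : 0 < δ) (hWl : 0 < Wl) :
    ∫ T, X.muHat T ∂X.law = X.tte := by
  simp only [← sum_inv_card_mul_effectHat]
  rw [tte, integral_finsetSum _ fun _ _ => .of_finite, Finset.mul_sum]
  refine Finset.sum_congr rfl fun a _ => ?_
  rw [integral_const_mul, h.integral_effectHat
    (abs_pos.1 (h.abs_covariance_exposure_instrument_pos hδ hWl a))]

theorem varMuHat_le (h : X.AsymptoticAssumptions δ Wl Wh M) (hδ : 0 < δ) (hWl : 0 < Wl) :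
    X.varMuHat ≤ (M * Wh / (δ ^ 3 * Wl)) ^ 2 * (X.degA ^ 3 * X.degR / Fintype.card A) := by
  have hvar := (h.isDependencyGraph_mul_effectHat _).variance_sum_le
    (fun a => .of_forall (h.abs_inv_card_mul_effectHat_le hδ hWl a)) h.card_closedNeighborFinset_le
  simp only [sum_inv_card_mul_effectHat] at hvar
  calc X.varMuHat
      ≤ Fintype.card A * (X.degA * X.degR : ℕ) *
          (M * Wh / (δ ^ 3 * Wl) * X.degA / Fintype.card A) ^ 2 := hvar
    _ = (M * Wh / (δ ^ 3 * Wl)) ^ 2 * (X.degA ^ 3 * X.degR / Fintype.card A) := by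
        rcases eq_or_ne (Fintype.card A : ℝ) 0 with hA | hA
        · simp [hA]
        · push_cast
          field_simp

theorem law_real_abs_muHat_sub_tte_ge_le (h : X.AsymptoticAssumptions δ Wl Wh M) (hδ : 0 < δ)
    (hWl : 0 < Wl) {ε : ℝ} (hε : 0 < ε) :
    X.law.real {T | ε ≤ |X.muHat T - X.tte|} ≤ X.varMuHat / ε ^ 2 := by
  rw [← h.integral_muHat hδ hWl]
  exact ENNReal.toReal_le_of_le_ofReal (div_nonneg (variance_nonneg _ _) (by positivity))
    (meas_ge_le_variance_div_sq .of_discrete hε)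

end AsymptoticAssumptions

end Estimator

section Sequences

variable {A R : ℕ → Type*} [∀ n, Fintype (A n)] [∀ n, Fintype (R n)]
  {X : ∀ n, BipartiteExperiment (A n) (R n)} {δ Wl Wh M : ℝ}

theorem tendsto_law_real_abs_muHat_sub_tte_ge
    (h : ∀ n, (X n).AsymptoticAssumptions δ Wl Wh M) (hδ : 0 < δ) (hWl : 0 < Wl)
    (hlim : Tendsto (fun n => ((X n).degA : ℝ) ^ 3 * (X n).degR / Fintype.card (A n)) atTop (𝓝 0))
    {ε : ℝ} (hε : 0 < ε) :
    Tendsto (fun n => (X n).law.real {T | ε ≤ |(X n).muHat T - (X n).tte|}) atTop (𝓝 0) := by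
  refine squeeze_zero (fun _ => measureReal_nonneg) (fun n =>
    ((h n).law_real_abs_muHat_sub_tte_ge_le hδ hWl hε).trans
      (div_le_div_of_nonneg_right ((h n).varMuHat_le hδ hWl) (by positivity))) ?_
  simpa using (hlim.const_mul ((M * Wh / (δ ^ 3 * Wl)) ^ 2)).div_const (ε ^ 2)

theorem tendstoInDistribution_standardized_muHat
    (h : ∀ n, (X n).AsymptoticAssumptions δ Wl Wh M) (hδ : 0 < δ) (hWl : 0 < Wl)
    (hvar : ∀ᶠ n in atTop, 0 < (X n).varMuHat)
    (hlim : Tendsto (fun n => ((X n).degA : ℝ) ^ 5 * (X n).degR ^ 2 /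
      (Fintype.card (A n) ^ 2 * √(X n).varMuHat ^ 3)) atTop (𝓝 0)) :
    TendstoInDistribution (fun n T => ((X n).muHat T - (X n).tte) / √(X n).varMuHat)
      atTop (id : ℝ → ℝ) (fun n => (X n).law) (gaussianReal 0 1) := by
  set K := M * Wh / (δ ^ 3 * Wl)
  have hratio (n : ℕ) : Fintype.card (A n) * (((X n).degA * (X n).degR : ℕ) : ℝ) ^ 2 *
      (K * (X n).degA / Fintype.card (A n)) ^ 3 / √(X n).varMuHat ^ 3 =
        K ^ 3 * (((X n).degA : ℝ) ^ 5 * (X n).degR ^ 2 /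
          (Fintype.card (A n) ^ 2 * √(X n).varMuHat ^ 3)) := by
    rcases eq_or_ne (Fintype.card (A n) : ℝ) 0 with hA | hA
    · simp [hA]
    · push_cast
      field_simp
  have hclt := IsDependencyGraph.tendstoInDistribution_standardized_sum
    (fun n => (h n).isDependencyGraph_mul_effectHat (1 / Fintype.card (A n)))
    (fun n a => .of_forall ((h n).abs_inv_card_mul_effectHat_le hδ hWl a))
    (fun n => (h n).card_closedNeighborFinset_le)
  simp only [sum_inv_card_mul_effectHat, (h _).integral_muHat hδ hWl] at hclt
  have hlim' := hlim.const_mul (K ^ 3)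
  rw [mul_zero] at hlim'
  exact hclt hvar (hlim'.congr fun n => (hratio n).symm)

end Sequences

end BipartiteExperiment

section LyapunovRatio

theorem abs_lyapunovRatio_le_sqrt {n v κ : ℝ} (d e : ℝ) (hn : 0 ≤ n) (hκ : 0 < κ)
    (hv : κ ≤ n * v) :
    |d ^ 5 * e ^ 2 / (n ^ 2 * √v ^ 3)| ≤ √(1 / κ ^ 3 * (d ^ 10 * e ^ 4 / n)) := by
  have hv_pos : 0 < v := pos_of_mul_pos_right (hκ.trans_le hv) hn
  have hn_pos : 0 < n := pos_of_mul_pos_left (hκ.trans_le hv) hv_pos.le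
  have hsq : (√v ^ 3) ^ 2 = v ^ 3 := by rw [← pow_mul, pow_mul', Real.sq_sqrt hv_pos.le]
  refine Real.abs_le_sqrt ?_
  calc (d ^ 5 * e ^ 2 / (n ^ 2 * √v ^ 3)) ^ 2
      = 1 / (n * v) ^ 3 * (d ^ 10 * e ^ 4 / n) := by
        rw [div_pow, mul_pow (n ^ 2), hsq]
        field_simp
    _ ≤ 1 / κ ^ 3 * (d ^ 10 * e ^ 4 / n) := by gcongr

theorem tendsto_lyapunovRatio {ι : Type*} {l : Filter ι} {n v d e : ι → ℝ} {κ : ℝ}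
    (hn : ∀ i, 0 ≤ n i) (hκ : 0 < κ) (hv : ∀ᶠ i in l, κ ≤ n i * v i)
    (hlim : Tendsto (fun i => d i ^ 10 * e i ^ 4 / n i) l (𝓝 0)) :
    Tendsto (fun i => d i ^ 5 * e i ^ 2 / (n i ^ 2 * √(v i) ^ 3)) l (𝓝 0) := by
  have hsqrt : Tendsto (fun i => √(1 / κ ^ 3 * (d i ^ 10 * e i ^ 4 / n i))) l (𝓝 0) := by
    simpa only [mul_zero, Real.sqrt_zero] using (hlim.const_mul (1 / κ ^ 3)).sqrt
  exact squeeze_zero_norm'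
    (hv.mono fun i hi => abs_lyapunovRatio_le_sqrt (d i) (e i) (hn i) hκ hi) hsqrt

end LyapunovRatio

theorem theorem2_general {δ Wl Wh M : ℝ} (hδ : 0 < δ) (hWl : 0 < Wl) :
    (∀ {A R : Type*} [Fintype A] [Fintype R] (X : BipartiteExperiment A R),
      X.AsymptoticAssumptions δ Wl Wh M →
        X.varMuHat ≤ (M * Wh / (δ ^ 3 * Wl)) ^ 2 * (X.degA ^ 3 * X.degR / Fintype.card A)) ∧
    ∀ {A R : ℕ → Type*} [∀ n, Fintype (A n)] [∀ n, Fintype (R n)]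
      (X : ∀ n, BipartiteExperiment (A n) (R n)),
      (∀ n, (X n).AsymptoticAssumptions δ Wl Wh M) →
        (Tendsto (fun n => ((X n).degA : ℝ) ^ 3 * (X n).degR / Fintype.card (A n))
            atTop (𝓝 0) →
          ∀ ε : ℝ, 0 < ε →
            Tendsto (fun n => (X n).law.real {T | ε ≤ |(X n).muHat T - (X n).tte|})
              atTop (𝓝 0)) ∧
        ((∀ᶠ n in atTop, 0 < (X n).varMuHat) →
          Tendsto (fun n => ((X n).degA : ℝ) ^ 5 * (X n).degR ^ 2 /
            (Fintype.card (A n) ^ 2 * √(X n).varMuHat ^ 3)) atTop (𝓝 0) →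
          TendstoInDistribution (fun n T => ((X n).muHat T - (X n).tte) / √(X n).varMuHat)
            atTop (id : ℝ → ℝ) (fun n => (X n).law) (gaussianReal 0 1)) :=
  ⟨fun _ h => h.varMuHat_le hδ hWl, fun _ h =>
    ⟨fun hlim _ hε => BipartiteExperiment.tendsto_law_real_abs_muHat_sub_tte_ge h hδ hWl hlim hε,
      BipartiteExperiment.tendstoInDistribution_standardized_muHat h hδ hWl⟩⟩

theorem theorem2 (δ Wl Wh M : ℝ) (hδ : 0 < δ) (hWl : 0 < Wl) (hWh : 0 < Wh) (hM : 0 < M) :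
    (∃ C : ℝ, ∀ (nA nR : ℕ) (X : BipartiteExperiment (Fin nA) (Fin nR)),
      X.AsymptoticAssumptions δ Wl Wh M →
        X.varMuHat ≤ C * ((X.degA : ℝ) ^ 3 * (X.degR : ℝ) / (nA : ℝ))) ∧
    ∀ (nA nR : ℕ → ℕ) (X : ∀ n, BipartiteExperiment (Fin (nA n)) (Fin (nR n))),
      (∀ n, (X n).AsymptoticAssumptions δ Wl Wh M) →
        (Tendsto (fun n => ((X n).degA : ℝ) ^ 3 * ((X n).degR : ℝ) / (nA n : ℝ)) atTop (𝓝 0) →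
          ∀ ε : ℝ, 0 < ε →
            Tendsto (fun n => (X n).law.real {T | ε ≤ |(X n).muHat T - (X n).tte|})
              atTop (𝓝 0)) ∧
        ((∃ κ : ℝ, 0 < κ ∧ ∀ᶠ n in atTop, κ ≤ (nA n : ℝ) * (X n).varMuHat) →
          Tendsto (fun n => ((X n).degA : ℝ) ^ 10 * ((X n).degR : ℝ) ^ 4 / (nA n : ℝ))
            atTop (𝓝 0) →
          TendstoInDistribution
            (fun n (T : Fin (nR n) → Bool) =>
              ((X n).muHat T - (X n).tte) / Real.sqrt (X n).varMuHat)
            atTop (id : ℝ → ℝ) (fun n => (X n).law) (gaussianReal 0 1)) := by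
  obtain ⟨hvariance, hlimits⟩ := theorem2_general (Wh := Wh) (M := M) hδ hWl
  refine ⟨⟨_, fun nA nR X h => by simpa only [Fintype.card_fin] using hvariance X h⟩,
    fun nA nR X h => ?_⟩
  obtain ⟨hconsistent, hnormal⟩ := hlimits X h
  simp only [Fintype.card_fin] at hconsistent hnormal
  refine ⟨hconsistent, fun ⟨κ, hκ, hvar⟩ hlim => ?_⟩
  exact hnormal (hvar.mono fun n hn => pos_of_mul_pos_right (hκ.trans_le hn) (Nat.cast_nonneg _))
    (tendsto_lyapunovRatio (fun n => Nat.cast_nonneg (nA n)) hκ hvar hlim)
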